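/- **Setting.** Let $c>0$, $\varepsilon_0\in\mathbb R$, and let $\mathcal M,\hat{\mathcal M}$ be open subsets of $\mathbb R^4$ with coordinates $(x^0,x^1,x^2,x^3)=(t,x,y,z)$, each with the Minkowski metric $-c^2dt^2+dx^2+dy^2+dz^2$, the orientation $dt\wedge dx\wedge dy\wedge dz$ and the Hodge dual $\star$ (resp. $\hat\star$) given by $\star 1=c\,dt\wedge dx\wedge dy\wedge dz$ and $\star(\alpha\wedge dx^a)=g^{ab}\,i_{\partial_b}\star\alpha$. Let $\varphi:\hat{\mathcal M}\to\mathcal M$ be an orientation-preserving (smooth) diffeomorphism, and let $\varphi_{XY}=\varphi\times\varphi:\hat{\mathcal M}\times\hat{\mathcal M}\to\mathcal M\times\mathcal M$. A *kernel* on $\mathcal M$ is a distributional form $\kappa=\tfrac14\kappa_{abcd}(x,y)\,dx^a\wedge dx^b\wedge dy^c\wedge dy^d$ on $\mathcal M_X\times\mathcal M_Y$ (two copies of $\mathcal M$), i.e. a continuous linear functional $\alpha\mapsto\int_{\mathcal M_X\times\mathcal M_Y}\alpha\wedge\kappa$ on smooth compactly supported forms $\alpha$ of bidegree $(2,2)$.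 Pullbacks, $d$ and $\star$ of distributional forms, and the Hodge dual $\star_X$ acting on the $x$-directions of a kernel, are defined by duality with test forms. The kernel $\Delta=\tfrac14\epsilon_{abcd}\,\delta^4(x-y)\,dx^a\wedge dx^b\wedge dy^c\wedge dy^d$ is given by $\int\alpha\wedge\Delta=\int_{\mathcal M}\gamma^*\alpha$ with $\gamma(x)=(x,x)$; $\hat\Delta$ is the same kernel on $\hat{\mathcal M}$. For a kernel $\kappa$ and a smooth 2-form $F$, we say that the integral $\Pi=\int_{\mathcal M_Y}\kappa\wedge\pi_Y^*F$, i.e. $\Pi_{ab}(x)=\tfrac14\epsilon^{cdef}\int\kappa_{abcd}(x,y)F_{ef}(y)\,d^4y$, exists and equals the distributional 2-form $\Pi$ if for every test 2-form $\psi$ the number $\int_{\mathcal M}\psi\wedge\Pi$ is the limit of $\int\pi_X^*\psi\wedge\pi_Y^*(\chi F)\wedge\kappa$ as the smooth compactly supported cutoffs $0\le\chi\le1$ become $1$ on larger and larger compact subsets of $\mathcal M$. **Transformed objects.** Put $\hat F=\varphi^*F$, $\hat J=\hat\star^{-1}\varphi^*\star J$, and for a kernel $\kappa$ on $\mathcal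 M$ $$\hat\kappa=\hat Z_X^{-1}\,\varphi_{XY}^*(\varepsilon_0\Delta+\kappa)-\varepsilon_0\hat\Delta,\qquad \hat Z_X^{-1}=\hat\star_X^{-1}\,\varphi_{XY}^*\,\star_X\,(\varphi_{XY}^{-1})^* .$$ **Statement.** Let $\kappa$ be a kernel on $\mathcal M$, $F$ a smooth 2-form on $\mathcal M$ with $dF=0$, $\Pi$ a 2-form and $J$ a 1-form on $\mathcal M$ such that $$\Pi=\int_{\mathcal M_Y}\kappa\wedge\pi_Y^*F,\qquad d\star(\varepsilon_0F+\Pi)=c^{-2}\star J .$$ Then the integral $\hat\Pi=\int_{\hat{\mathcal M}_Y}\hat\kappa\wedge\pi_Y^*\hat F$ exists (and is unique), and $$d\hat F=0,\qquad d\,\hat\star(\varepsilon_0\hat F+\hat\Pi)=c^{-2}\,\hat\star\hat J .$$ This holds for distributional $\Pi$ and $J$; and if $\Pi$ and $J$ are smooth and satisfy Maxwell's equation pointwise, then $\hat\Pi$ is smooth and the transformed equation holds pointwise. -/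

import Mathlib

open Set TopologicalSpace
open scoped ContDiff Distributions

noncomputable section

namespace SpacetimeOptics

section ProperMaps

variable {E E' F F' : Type*}
  [NormedAddCommGroup E] [NormedSpace ℝ E] [NormedAddCommGroup E'] [NormedSpace ℝ E']
  [NormedAddCommGroup F] [NormedSpace ℝ F] [NormedAddCommGroup F'] [NormedSpace ℝ F']

/-- A smooth proper map between open sets (only the values on `Ω'` matter). -/
structure ProperSmoothMap (Ω' : Opens E') (Ω : Opens E) where
  toFun : E' → E
  smooth : ContDiffOn ℝ ∞ toFun Ω'
  mapsTo : MapsTo toFun Ω' Ω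
  proper : ∀ K : Set E, IsCompact K → K ⊆ Ω → IsCompact (Ω' ∩ toFun ⁻¹' K)

/-- A function which is smooth on an open set and vanishes off a compact (closed) part of it
is smooth. -/
theorem contDiff_of_smoothOn_of_zero {Ω : Opens E} {h : E → F} {K : Set E} (hK : IsClosed K)
    (hKΩ : K ⊆ Ω) (hs : ContDiffOn ℝ ∞ h Ω) (h0 : ∀ x ∉ K, h x = 0) : ContDiff ℝ ∞ h := by
  rw [contDiff_iff_contDiffAt]
  intro x
  by_cases hx : x ∈ K
  · exact hs.contDiffAt (Ω.isOpen.mem_nhds (hKΩ hx))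
  · have : h =ᶠ[nhds x] fun _ => 0 := by
      filter_upwards [hK.isOpen_compl.mem_nhds hx] with y hy using h0 y hy
    exact contDiffAt_const.congr_of_eventuallyEq this

theorem exists_deriv_bound {u : E → F} {Ω : Opens E} {K : Set E} (hK : IsCompact K)
    (hKΩ : K ⊆ Ω) (hu : ContDiffOn ℝ ∞ u Ω) (i : ℕ) :
    ∃ D : ℝ, 1 ≤ D ∧ ∀ j ≤ i, ∀ y ∈ K, ‖iteratedFDerivWithin ℝ j u Ω y‖ ≤ D := by
  have h1 (j : ℕ) : ∃ D : ℝ, ∀ y ∈ K, ‖iteratedFDerivWithin ℝ j u Ω y‖ ≤ D :=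
    hK.exists_bound_of_continuousOn
      ((hu.continuousOn_iteratedFDerivWithin (mod_cast le_top) Ω.isOpen.uniqueDiffOn).mono hKΩ)
  choose D hD using h1
  refine ⟨1 + ∑ j ∈ Finset.range (i + 1), |D j|, ?_, ?_⟩
  · have : 0 ≤ ∑ j ∈ Finset.range (i + 1), |D j| := Finset.sum_nonneg fun _ _ => abs_nonneg _
    linarith
  · intro j hj y hy
    have h2 : |D j| ≤ ∑ j ∈ Finset.range (i + 1), |D j| :=
      Finset.single_le_sum (f := fun j => |D j|) (fun _ _ => abs_nonneg _)
        (Finset.mem_range_succ_iff.2 hj)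
    linarith [hD j y hy, le_abs_self (D j)]

variable {Ω : Opens E} {Ω' : Opens E'}

/-- The function `y ↦ A(y) f(g(y))` on `Ω'`, extended by zero. -/
def weightedCompFun (g : ProperSmoothMap Ω' Ω) (A : E' → F →L[ℝ] F') (f : E → F) : E' → F' :=
  (Ω' : Set E').indicator fun y => A y (f (g.toFun y))

theorem weightedCompFun_zero (g : ProperSmoothMap Ω' Ω) (A : E' → F →L[ℝ] F') {f : E → F}
    {K : Set E} (hf : ∀ x ∉ K, f x = 0) (y : E') (hy : y ∉ (Ω' : Set E') ∩ g.toFun ⁻¹' K) :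
    weightedCompFun g A f y = 0 := by
  unfold weightedCompFun
  by_cases h : y ∈ (Ω' : Set E')
  · rw [indicator_of_mem h, hf, map_zero]
    exact fun h' => hy ⟨h, h'⟩
  · exact indicator_of_notMem h _

theorem weightedCompFun_add (g : ProperSmoothMap Ω' Ω) (A : E' → F →L[ℝ] F') (f h : E → F)
    (y : E') : weightedCompFun g A (f + h) y = weightedCompFun g A f y + weightedCompFun g A h y := by
  by_cases hy : y ∈ (Ω' : Set E')
  · simp only [weightedCompFun, indicator_of_mem hy, Pi.add_apply, map_add]
  · simp only [weightedCompFun, indicator_of_notMem hy, add_zero]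

theorem weightedCompFun_smul (g : ProperSmoothMap Ω' Ω) (A : E' → F →L[ℝ] F') (c : ℝ) (f : E → F)
    (y : E') : weightedCompFun g A (c • f) y = c • weightedCompFun g A f y := by
  by_cases hy : y ∈ (Ω' : Set E')
  · simp only [weightedCompFun, indicator_of_mem hy, Pi.smul_apply, map_smul]
  · simp only [weightedCompFun, indicator_of_notMem hy, smul_zero]

theorem weightedCompFun_contDiffOn (g : ProperSmoothMap Ω' Ω) {A : E' → F →L[ℝ] F'}
    (hA : ContDiffOn ℝ ∞ A Ω') {f : E → F} (hf : ContDiff ℝ ∞ f) :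
    ContDiffOn ℝ ∞ (weightedCompFun g A f) Ω' := by
  have : ContDiffOn ℝ ∞ (fun y => A y (f (g.toFun y))) Ω' :=
    hA.clm_apply (hf.comp_contDiffOn g.smooth)
  exact this.congr fun y hy => indicator_of_mem hy _

theorem weightedCompFun_contDiff (g : ProperSmoothMap Ω' Ω) {A : E' → F →L[ℝ] F'}
    (hA : ContDiffOn ℝ ∞ A Ω') {f : E → F} (hf : ContDiff ℝ ∞ f) {K : Set E} (hK : IsCompact K)
    (hKΩ : K ⊆ Ω) (hfK : ∀ x ∉ K, f x = 0) :
    ContDiff ℝ ∞ (weightedCompFun g A f) :=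
  contDiff_of_smoothOn_of_zero (g.proper K hK hKΩ).isClosed inter_subset_left
    (weightedCompFun_contDiffOn g hA hf) (weightedCompFun_zero g A hfK)

theorem weightedCompFun_bound (g : ProperSmoothMap Ω' Ω) {A : E' → F →L[ℝ] F'}
    (hA : ContDiffOn ℝ ∞ A Ω') (K : Compacts E) (hKΩ : (K : Set E) ⊆ Ω) (i : ℕ) :
    ∃ (s : Finset ℕ) (C : ℝ), 0 ≤ C ∧ ∀ f : 𝓓_{K}(E, F), ∀ y ∈ (Ω' : Set E') ∩ g.toFun ⁻¹' K,
      ‖iteratedFDeriv ℝ i (weightedCompFun g A f) y‖ ≤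
        C * (s.sup fun j ↦ ContDiffMapSupportedIn.seminorm ℝ E F ⊤ K j) f := by
  have hK' := g.proper K K.isCompact hKΩ
  have hu : UniqueDiffOn ℝ (Ω' : Set E') := Ω'.isOpen.uniqueDiffOn
  have hn (m : ℕ) : (m : WithTop ℕ∞) ≤ ∞ := mod_cast le_top
  obtain ⟨D, hD1, hD⟩ := exists_deriv_bound hK' inter_subset_left g.smooth i
  obtain ⟨D', hD'1, hD'⟩ := exists_deriv_bound hK' inter_subset_left hA i
  let B : (F →L[ℝ] F') →L[ℝ] F →L[ℝ] F' := ContinuousLinearMap.id ℝ _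
  refine ⟨Finset.Iic i, ‖B‖ * ∑ k ∈ Finset.range (i + 1),
    (i.choose k : ℝ) * D' * ((i - k).factorial * D ^ (i - k)), by positivity, fun f y hy => ?_⟩
  set S := ((Finset.Iic i).sup fun j ↦ ContDiffMapSupportedIn.seminorm ℝ E F ⊤ K j) f with hS
  have hS0 : 0 ≤ S := apply_nonneg _ _
  have hf : ContDiff ℝ ∞ f := f.contDiff
  have e1 : iteratedFDeriv ℝ i (weightedCompFun g A f) y =
      iteratedFDerivWithin ℝ i (fun y => B (A y) ((f ∘ g.toFun) y)) Ω' y := by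
    rw [← iteratedFDerivWithin_of_isOpen i Ω'.isOpen hy.1]
    exact iteratedFDerivWithin_congr (fun z hz => indicator_of_mem hz _) hy.1 i
  rw [e1]
  refine (B.norm_iteratedFDerivWithin_le_of_bilinear hA (hf.comp_contDiffOn g.smooth) hu hy.1
    (n := i) (mod_cast le_top)).trans ?_
  rw [mul_assoc, Finset.sum_mul]
  refine mul_le_mul_of_nonneg_left (Finset.sum_le_sum fun k hk => ?_) (norm_nonneg B)
  have hk' : k ≤ i := Finset.mem_range_succ_iff.1 hk
  have e2 : ‖iteratedFDerivWithin ℝ (i - k) (f ∘ g.toFun) Ω' y‖ ≤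
      (i - k).factorial * S * D ^ (i - k) := by
    refine norm_iteratedFDerivWithin_comp_le (N := ∞) (t := univ) hf.contDiffOn g.smooth
      (n := i - k) (hn (i - k)) uniqueDiffOn_univ hu (mapsTo_univ _ _) hy.1 ?_ ?_
    · intro j hj
      rw [iteratedFDerivWithin_univ]
      refine (ContDiffMapSupportedIn.norm_iteratedFDeriv_apply_le_seminorm ℝ
        (by exact le_top)).trans ?_
      exact Seminorm.le_finset_sup_apply (Finset.mem_Iic.2 (hj.trans (Nat.sub_le i k)))
    · intro j hj1 hj
      exact (hD j (hj.trans (Nat.sub_le i k)) y hy).trans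
        (le_self_pow₀ hD1 (by omega))
  calc _ ≤ (i.choose k : ℝ) * D' * ((i - k).factorial * S * D ^ (i - k)) := by
        gcongr
        exact hD' k hk' y hy
    _ = _ := by ring

/-- `weightedCompFun` on test functions supported in a fixed compact set. -/
def weightedCompAux (g : ProperSmoothMap Ω' Ω) (A : E' → F →L[ℝ] F') (hA : ContDiffOn ℝ ∞ A Ω')
    (K : Compacts E) (hK : (K : Set E) ⊆ Ω) (K' : Compacts E')
    (hK' : (K' : Set E') = (Ω' : Set E') ∩ g.toFun ⁻¹' K) :
    𝓓_{K}(E, F) →L[ℝ] 𝓓_{K'}(E', F') :=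
  letI Φ : 𝓓_{K}(E, F) →ₗ[ℝ] 𝓓_{K'}(E', F') :=
    { toFun := fun f => ⟨weightedCompFun g A f,
        weightedCompFun_contDiff g hA f.contDiff K.isCompact hK fun x hx => f.zero_on_compl hx,
        fun y hy => weightedCompFun_zero g A (fun x hx => f.zero_on_compl hx) y
          (by rw [← hK']; exact hy)⟩
      map_add' := fun f h => by
        ext x
        exact weightedCompFun_add g A f h x
      map_smul' := fun c f => by
        ext x
        exact weightedCompFun_smul g A c f x }
  { toLinearMap := Φ
    cont := show Continuous Φ by
      refine WithSeminorms.continuous_of_isBounded (ContDiffMapSupportedIn.withSeminorms ..)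
        (ContDiffMapSupportedIn.withSeminorms ..) _ (.of_real fun i ↦ ?_)
      obtain ⟨s, C, hC, h⟩ := weightedCompFun_bound g hA K hK i
      exact ⟨s, C, fun f ↦ ((Φ f).seminorm_top_le_iff ℝ (mul_nonneg hC (apply_nonneg _ _)) i).2
          fun x hx ↦ h f x (by rw [← hK']; exact hx)⟩ }

/-- The continuous linear map `f ↦ (y ↦ A(y) f(g(y)))` between spaces of test functions. -/
def weightedComp (g : ProperSmoothMap Ω' Ω) (A : E' → F →L[ℝ] F') (hA : ContDiffOn ℝ ∞ A Ω') :
    𝓓(Ω, F) →L[ℝ] 𝓓(Ω', F') :=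
  TestFunction.limitCLM ℝ
    (fun f =>
      { toFun := weightedCompFun g A f
        contDiff' := weightedCompFun_contDiff g hA f.contDiff f.hasCompactSupport
          f.tsupport_subset fun x hx => image_eq_zero_of_notMem_tsupport hx
        hasCompactSupport' :=
          HasCompactSupport.intro (g.proper _ f.hasCompactSupport f.tsupport_subset)
            (weightedCompFun_zero g A fun x hx => image_eq_zero_of_notMem_tsupport hx)
        tsupport_subset' := by
          have hc := g.proper _ f.hasCompactSupport f.tsupport_subset
          refine (closure_minimal ?_ hc.isClosed).trans inter_subset_left
          intro y hy
          by_contra h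
          exact hy (weightedCompFun_zero g A
            (fun x hx => image_eq_zero_of_notMem_tsupport hx) y h) })
    (fun K hK =>
      (TestFunction.ofSupportedInCLM ℝ
        (K := ⟨(Ω' : Set E') ∩ g.toFun ⁻¹' K, g.proper K K.isCompact hK⟩) inter_subset_left).comp
        (weightedCompAux g A hA K hK _ rfl))
    (fun K hK f => rfl)

theorem weightedComp_apply (g : ProperSmoothMap Ω' Ω) (A : E' → F →L[ℝ] F')
    (hA : ContDiffOn ℝ ∞ A Ω') (f : 𝓓(Ω, F)) {y : E'} (hy : y ∈ Ω') :
    weightedComp g A hA f y = A y (f (g.toFun y)) :=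
  indicator_of_mem (s := (Ω' : Set E')) hy (fun y => A y (f (g.toFun y)))

end ProperMaps

/-! ### Exterior algebra of Minkowski spacetime -/

/-- Spacetime, with its global Minkowski coordinates `(x⁰, x¹, x², x³) = (t, x, y, z)`. -/
abbrev Spacetime := Fin 4 → ℝ

/-- Alternating `k`-forms on the tangent space with values in `W`. -/
abbrev Alt (k : ℕ) (W : Type*) [NormedAddCommGroup W] [NormedSpace ℝ W] :=
  Spacetime [⋀^Fin k]→L[ℝ] W

/-- Elements `¼ α_{abcd} dxᵃ ∧ dxᵇ ∧ dyᶜ ∧ dyᵈ` of bidegree `(2,2)` on the tangent space of the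
product of two copies of spacetime: 2-forms in the `x` directions with values in 2-forms in the
`y` directions, so that `α_{abcd} = α ![∂_a, ∂_b] ![∂_c, ∂_d]`. -/
abbrev Alt22 := Alt 2 (Alt 2 ℝ)

/-- The coordinate vector `∂_a`. -/
def coordVec (a : Fin 4) : Spacetime := Pi.single a 1

section Algebra

variable {W : Type*} [NormedAddCommGroup W] [NormedSpace ℝ W]

/-- The inverse of the Minkowski metric `-c² dt² + dx² + dy² + dz²` in coordinates `(t,x,y,z)`
(the diagonal entries `g^{aa}`; the others vanish). -/
def metricInv (c : ℝ) : Fin 4 → ℝ := ![-(c ^ 2)⁻¹, 1, 1, 1]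

/-- The metric volume form `⋆1 = c dt ∧ dx ∧ dy ∧ dz`. -/
def volForm (c : ℝ) : Alt 4 ℝ :=
  c • { toMultilinearMap := (Matrix.detRowAlternating (R := ℝ) (n := Fin 4)).toMultilinearMap
        cont := by
          change Continuous fun A : Fin 4 → Fin 4 → ℝ => Matrix.det (A : Matrix (Fin 4) (Fin 4) ℝ)
          exact Continuous.matrix_det continuous_id
        map_eq_zero_of_eq' := (Matrix.detRowAlternating (R := ℝ) (n := Fin 4)).map_eq_zero_of_eq' }

/-- `w ↦ β ⊗ w`, for a scalar form `β` and a coefficient `w`. -/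
def tensorCoeff {k : ℕ} (β : Alt k ℝ) : W →L[ℝ] Alt k W :=
  ((ContinuousLinearMap.compContinuousAlternatingMapCLM ℝ Spacetime ℝ W (Fin k)).flip β).comp
    (ContinuousLinearMap.smulRightL ℝ ℝ W (ContinuousLinearMap.id ℝ ℝ))

theorem tensorCoeff_apply {k : ℕ} (β : Alt k ℝ) (w : W) (v : Fin k → Spacetime) :
    tensorCoeff β w v = β v • w := rfl

/-- The Hodge dual of 1-forms. On each degree the Hodge dual is the tensorial operation with
`⋆(dx^{a₁} ∧ … ∧ dx^{aₚ}) = i_{♯dx^{aₚ}} ⋯ i_{♯dx^{a₁}} ⋆1`, equivalently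
`⋆(α ∧ dxᵃ) = g^{ab} i_{∂_b} ⋆α`. Coefficients in `W` are carried along. -/
def star₁ (c : ℝ) : Alt 1 W →L[ℝ] Alt 3 W :=
  ∑ a, metricInv c a •
    (tensorCoeff ((volForm c).curryLeft (coordVec a))).comp
      (ContinuousAlternatingMap.apply ℝ Spacetime W ![coordVec a])

/-- The Hodge dual of 2-forms. -/
def star₂ (c : ℝ) : Alt 2 W →L[ℝ] Alt 2 W :=
  (1 / 2 : ℝ) • ∑ a, ∑ b, (metricInv c a * metricInv c b) •
    (tensorCoeff (((volForm c).curryLeft (coordVec a)).curryLeft (coordVec b))).comp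
      (ContinuousAlternatingMap.apply ℝ Spacetime W ![coordVec a, coordVec b])

/-- The Hodge dual of 3-forms. -/
def star₃ (c : ℝ) : Alt 3 W →L[ℝ] Alt 1 W :=
  (1 / 6 : ℝ) • ∑ a, ∑ b, ∑ d, (metricInv c a * metricInv c b * metricInv c d) •
    (tensorCoeff ((((volForm c).curryLeft (coordVec a)).curryLeft (coordVec b)).curryLeft
      (coordVec d))).comp
      (ContinuousAlternatingMap.apply ℝ Spacetime W ![coordVec a, coordVec b, coordVec d])

end Algebra

section AlgebraFacts

variable {W : Type*} [NormedAddCommGroup W] [NormedSpace ℝ W]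

theorem volForm_apply (c : ℝ) (v : Fin 4 → Spacetime) :
    volForm c v = c * Matrix.det (Matrix.of v) := rfl

theorem ext_coord {k : ℕ} {α β : Alt k W}
    (h : ∀ i : Fin k → Fin 4, Function.Injective i →
      α (fun j => coordVec (i j)) = β (fun j => coordVec (i j))) : α = β := by
  apply ContinuousAlternatingMap.toAlternatingMap_injective
  apply Module.Basis.ext_alternating (Pi.basisFun ℝ (Fin 4))
  intro v hv
  simpa [coordVec] using h v hv

theorem star₁_apply (c : ℝ) (α : Alt 1 W) (u v w : Spacetime) :
    star₁ c α ![u, v, w] =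
      ∑ a, (metricInv c a * volForm c ![coordVec a, u, v, w]) • α ![coordVec a] := by
  simp [star₁, tensorCoeff_apply, ContinuousAlternatingMap.sum_apply, mul_smul]

theorem star₂_apply (c : ℝ) (α : Alt 2 W) (u v : Spacetime) :
    star₂ c α ![u, v] = (1 / 2 : ℝ) • ∑ a, ∑ b,
      (metricInv c a * metricInv c b * volForm c ![coordVec a, coordVec b, u, v]) •
        α ![coordVec a, coordVec b] := by
  simp [star₂, tensorCoeff_apply, ContinuousAlternatingMap.sum_apply, mul_smul]

theorem star₃_apply (c : ℝ) (α : Alt 3 W) (u : Spacetime) :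
    star₃ c α ![u] = (1 / 6 : ℝ) • ∑ a, ∑ b, ∑ d,
      (metricInv c a * metricInv c b * metricInv c d *
        volForm c ![coordVec a, coordVec b, coordVec d, u]) •
        α ![coordVec a, coordVec b, coordVec d] := by
  simp [star₃, tensorCoeff_apply, ContinuousAlternatingMap.sum_apply, mul_smul]

theorem alt2_swap (α : Alt 2 W) (u v : Spacetime) : α ![u, v] = -α ![v, u] := by
  have := α.toAlternatingMap.map_swap ![v, u] (i := 0) (j := 1) (by decide)
  have h : (![v, u] ∘ (Equiv.swap (0 : Fin 2) 1)) = ![u, v] := by ext i; fin_cases i <;> rfl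
  rw [h] at this
  exact this

theorem coordVec_zero : coordVec 0 = ![1, 0, 0, 0] := by ext i; fin_cases i <;> rfl
theorem coordVec_one : coordVec 1 = ![0, 1, 0, 0] := by ext i; fin_cases i <;> rfl
theorem coordVec_two : coordVec 2 = ![0, 0, 1, 0] := by ext i; fin_cases i <;> rfl
theorem coordVec_three : coordVec 3 = ![0, 0, 0, 1] := by ext i; fin_cases i <;> rfl

theorem det_of_four (a b c d : Fin 4 → ℝ) : Matrix.det (Matrix.of ![a, b, c, d]) =
    (a 0 * b 1 - a 1 * b 0) * (c 2 * d 3 - c 3 * d 2)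
    - (a 0 * b 2 - a 2 * b 0) * (c 1 * d 3 - c 3 * d 1)
    + (a 0 * b 3 - a 3 * b 0) * (c 1 * d 2 - c 2 * d 1)
    + (a 1 * b 2 - a 2 * b 1) * (c 0 * d 3 - c 3 * d 0)
    - (a 1 * b 3 - a 3 * b 1) * (c 0 * d 2 - c 2 * d 0)
    + (a 2 * b 3 - a 3 * b 2) * (c 0 * d 1 - c 1 * d 0) := by
  simp [Matrix.det_succ_row_zero, Fin.sum_univ_succ, Fin.succAbove]
  ring

theorem star₂_coord (c : ℝ) (α : Alt 2 W) :
    star₂ c α ![coordVec 0, coordVec 1] = c • α ![coordVec 2, coordVec 3] ∧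
    star₂ c α ![coordVec 0, coordVec 2] = -c • α ![coordVec 1, coordVec 3] ∧
    star₂ c α ![coordVec 0, coordVec 3] = c • α ![coordVec 1, coordVec 2] ∧
    star₂ c α ![coordVec 1, coordVec 2] = (-(c ^ 2)⁻¹ * c) • α ![coordVec 0, coordVec 3] ∧
    star₂ c α ![coordVec 1, coordVec 3] = ((c ^ 2)⁻¹ * c) • α ![coordVec 0, coordVec 2] ∧
    star₂ c α ![coordVec 2, coordVec 3] = (-(c ^ 2)⁻¹ * c) • α ![coordVec 0, coordVec 1] := by
  have e1 := alt2_swap α (coordVec 3) (coordVec 2)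
  have e2 := alt2_swap α (coordVec 3) (coordVec 1)
  have e3 := alt2_swap α (coordVec 2) (coordVec 1)
  have e4 := alt2_swap α (coordVec 3) (coordVec 0)
  have e5 := alt2_swap α (coordVec 2) (coordVec 0)
  have e6 := alt2_swap α (coordVec 1) (coordVec 0)
  refine ⟨?_, ?_, ?_, ?_, ?_, ?_⟩ <;>
  · rw [star₂_apply]
    simp [Fin.sum_univ_four, metricInv, volForm_apply, det_of_four, coordVec_zero, coordVec_one,
      coordVec_two, coordVec_three] at e1 e2 e3 e4 e5 e6 ⊢
    simp only [e1, e2, e3, e4, e5, e6]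
    module

/-- `⋆⋆ = -1` on 2-forms (Lorentzian signature). -/
theorem star₂_star₂ {c : ℝ} (hc : c ≠ 0) (α : Alt 2 W) : star₂ c (star₂ c α) = -α := by
  obtain ⟨h1, h2, h3, h4, h5, h6⟩ := star₂_coord c (star₂ c α)
  obtain ⟨k1, k2, k3, k4, k5, k6⟩ := star₂_coord c α
  have hcc : (c ^ 2)⁻¹ * c * c = 1 := by field_simp
  have key : ∀ p q : Fin 4, p < q →
      star₂ c (star₂ c α) ![coordVec p, coordVec q] = -α ![coordVec p, coordVec q] := by
    intro p q hpq
    fin_cases p <;> fin_cases q <;> first | exact absurd hpq (by decide) | skip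
    · exact h1.trans (by
        rw [k6, smul_smul, show c * (-(c ^ 2)⁻¹ * c) = -1 by linear_combination -hcc, neg_one_smul]; rfl)
    · exact h2.trans (by
        rw [k5, smul_smul, show -c * ((c ^ 2)⁻¹ * c) = -1 by linear_combination -hcc, neg_one_smul]; rfl)
    · exact h3.trans (by
        rw [k4, smul_smul, show c * (-(c ^ 2)⁻¹ * c) = -1 by linear_combination -hcc, neg_one_smul]; rfl)
    · exact h4.trans (by
        rw [k3, smul_smul, show -(c ^ 2)⁻¹ * c * c = -1 by linear_combination -hcc, neg_one_smul]; rfl)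
    · exact h5.trans (by
        rw [k2, smul_smul, show (c ^ 2)⁻¹ * c * -c = -1 by linear_combination -hcc, neg_one_smul]; rfl)
    · exact h6.trans (by
        rw [k1, smul_smul, show -(c ^ 2)⁻¹ * c * c = -1 by linear_combination -hcc, neg_one_smul]; rfl)
  apply ext_coord
  intro i hi
  have h0 : (fun j => coordVec (i j)) = ![coordVec (i 0), coordVec (i 1)] := by
    ext j; fin_cases j <;> rfl
  rw [h0, ContinuousAlternatingMap.neg_apply]
  rcases lt_or_gt_of_ne (fun h => by simpa using hi h : i 0 ≠ i 1) with h | h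
  · exact key _ _ h
  · rw [alt2_swap, key _ _ h, alt2_swap α (coordVec (i 0))]

set_option maxHeartbeats 1000000 in
theorem star₁_coord (c : ℝ) (α : Alt 1 W) :
    star₁ c α ![coordVec 1, coordVec 2, coordVec 3] = (-(c^2)⁻¹ * c) • α ![coordVec 0] ∧
    star₁ c α ![coordVec 0, coordVec 2, coordVec 3] = -c • α ![coordVec 1] ∧
    star₁ c α ![coordVec 0, coordVec 1, coordVec 3] = c • α ![coordVec 2] ∧
    star₁ c α ![coordVec 0, coordVec 1, coordVec 2] = -c • α ![coordVec 3] := by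
  refine ⟨?_, ?_, ?_, ?_⟩ <;>
  · rw [star₁_apply]
    simp [Fin.sum_univ_four, metricInv, volForm_apply, det_of_four, coordVec_zero, coordVec_one,
      coordVec_two, coordVec_three] 

theorem alt3_swap01 (α : Alt 3 W) (u v w : Spacetime) : α ![u, v, w] = -α ![v, u, w] := by
  have := α.toAlternatingMap.map_swap ![v, u, w] (i := 0) (j := 1) (by decide)
  have h : (![v, u, w] ∘ (Equiv.swap (0 : Fin 3) 1)) = ![u, v, w] := by ext i; fin_cases i <;> rfl
  rw [h] at this
  exact this
theorem alt3_swap12 (α : Alt 3 W) (u v w : Spacetime) : α ![u, v, w] = -α ![u, w, v] := by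
  have := α.toAlternatingMap.map_swap ![u, w, v] (i := 1) (j := 2) (by decide)
  have h : (![u, w, v] ∘ (Equiv.swap (1 : Fin 3) 2)) = ![u, v, w] := by ext i; fin_cases i <;> rfl
  rw [h] at this
  exact this

set_option maxHeartbeats 1000000 in
theorem star₃_coord (c : ℝ) (α : Alt 3 W) :
    star₃ c α ![coordVec 0] = -c • α ![coordVec 1, coordVec 2, coordVec 3] ∧
    star₃ c α ![coordVec 1] = (-(c^2)⁻¹ * c) • α ![coordVec 0, coordVec 2, coordVec 3] ∧
    star₃ c α ![coordVec 2] = ((c^2)⁻¹ * c) • α ![coordVec 0, coordVec 1, coordVec 3] ∧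
    star₃ c α ![coordVec 3] = (-(c^2)⁻¹ * c) • α ![coordVec 0, coordVec 1, coordVec 2] := by
  have s (i j k : Fin 4) : 
     α ![coordVec i, coordVec k, coordVec j] = -α ![coordVec i, coordVec j, coordVec k] ∧
     α ![coordVec j, coordVec i, coordVec k] = -α ![coordVec i, coordVec j, coordVec k] ∧
     α ![coordVec j, coordVec k, coordVec i] = α ![coordVec i, coordVec j, coordVec k] ∧
     α ![coordVec k, coordVec i, coordVec j] = α ![coordVec i, coordVec j, coordVec k] ∧
     α ![coordVec k, coordVec j, coordVec i] = -α ![coordVec i, coordVec j, coordVec k] := by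
    refine ⟨alt3_swap12 _ _ _ _, alt3_swap01 _ _ _ _, ?_, ?_, ?_⟩
    · rw [alt3_swap12, alt3_swap01, neg_neg]
    · rw [alt3_swap01, alt3_swap12, neg_neg]
    · rw [alt3_swap01, alt3_swap12, alt3_swap01, neg_neg]
  obtain ⟨a1,a2,a3,a4,a5⟩ := s 1 2 3
  obtain ⟨b1,b2,b3,b4,b5⟩ := s 0 2 3
  obtain ⟨c1,c2,c3,c4,c5⟩ := s 0 1 3
  obtain ⟨d1,d2,d3,d4,d5⟩ := s 0 1 2
  refine ⟨?_, ?_, ?_, ?_⟩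
  · rw [star₃_apply]
    simp [Fin.sum_univ_four, metricInv, volForm_apply, det_of_four, coordVec_zero, coordVec_one,
      coordVec_two, coordVec_three] at a1 a2 a3 a4 a5 ⊢
    simp only [a1, a2, a3, a4, a5]
    module
  · rw [star₃_apply]
    simp [Fin.sum_univ_four, metricInv, volForm_apply, det_of_four, coordVec_zero, coordVec_one,
      coordVec_two, coordVec_three] at b1 b2 b3 b4 b5 ⊢
    simp only [b1, b2, b3, b4, b5]
    module
  · rw [star₃_apply]
    simp [Fin.sum_univ_four, metricInv, volForm_apply, det_of_four, coordVec_zero, coordVec_one,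
      coordVec_two, coordVec_three] at c1 c2 c3 c4 c5 ⊢
    simp only [c1, c2, c3, c4, c5]
    module
  · rw [star₃_apply]
    simp [Fin.sum_univ_four, metricInv, volForm_apply, det_of_four, coordVec_zero, coordVec_one,
      coordVec_two, coordVec_three] at d1 d2 d3 d4 d5 ⊢
    simp only [d1, d2, d3, d4, d5]
    module

/-- `⋆⋆ = 1` on 1-forms. -/
theorem star₃_star₁ {c : ℝ} (hc : c ≠ 0) (α : Alt 1 W) : star₃ c (star₁ c α) = α := by
  obtain ⟨h1, h2, h3, h4⟩ := star₃_coord c (star₁ c α)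
  obtain ⟨k1, k2, k3, k4⟩ := star₁_coord c α
  have hcc : (c ^ 2)⁻¹ * c * c = 1 := by field_simp
  rw [k1, smul_smul, show -c * (-(c ^ 2)⁻¹ * c) = 1 by linear_combination hcc, one_smul] at h1
  rw [k2, smul_smul, show -(c ^ 2)⁻¹ * c * -c = 1 by linear_combination hcc, one_smul] at h2
  rw [k3, smul_smul, hcc, one_smul] at h3
  rw [k4, smul_smul, show -(c ^ 2)⁻¹ * c * -c = 1 by linear_combination hcc, one_smul] at h4
  have key : ∀ p : Fin 4, star₃ c (star₁ c α) ![coordVec p] = α ![coordVec p] := by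
    intro p
    fin_cases p
    exacts [h1, h2, h3, h4]
  apply ext_coord
  intro i hi
  have h0 : (fun j => coordVec (i j)) = ![coordVec (i 0)] := by
    ext j; fin_cases j; rfl
  rw [h0, key]

end AlgebraFacts
section FormPullback

/-- The pullback of forms along a linear map `L` of tangent spaces. -/
abbrev pullAlt (k : ℕ) (W : Type*) [NormedAddCommGroup W] [NormedSpace ℝ W]
    (L : Spacetime →L[ℝ] Spacetime) : Alt k W →L[ℝ] Alt k W :=
  ContinuousAlternatingMap.compContinuousLinearMapCLM L

/-- Applying a linear map to the values of forms, as a linear operation in that map. -/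
def mapValues (k : ℕ) (W W' : Type*) [NormedAddCommGroup W] [NormedSpace ℝ W]
    [NormedAddCommGroup W'] [NormedSpace ℝ W'] :
    (W →L[ℝ] W') →L[ℝ] Alt k W →L[ℝ] Alt k W' :=
  ContinuousLinearMap.compContinuousAlternatingMapCLM ℝ Spacetime W W' (Fin k)

/-- `w ↦ (s ↦ s w)`. -/
def lineMap (W : Type*) [NormedAddCommGroup W] [NormedSpace ℝ W] : W →L[ℝ] ℝ →L[ℝ] W :=
  ContinuousLinearMap.smulRightL ℝ ℝ W (ContinuousLinearMap.id ℝ ℝ)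

theorem contDiff_lineMap (W : Type*) [NormedAddCommGroup W] [NormedSpace ℝ W] :
    ContDiff ℝ ∞ (lineMap W) := ContinuousLinearMap.contDiff _

/-- `β ⊗ w`, for a scalar form `β` and a coefficient `w`. -/
def tensorL (k : ℕ) (W : Type*) [NormedAddCommGroup W] [NormedSpace ℝ W] :
    Alt k ℝ →L[ℝ] W →L[ℝ] Alt k W :=
  ((ContinuousLinearMap.compL ℝ W (ℝ →L[ℝ] W) (Alt k W)).flip (lineMap W)).comp
    (mapValues k ℝ W).flip

theorem contDiff_tensorL (k : ℕ) (W : Type*) [NormedAddCommGroup W] [NormedSpace ℝ W] :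
    ContDiff ℝ ∞ (tensorL k W) := ContinuousLinearMap.contDiff _

/-- The pullback of elements of bidegree `(2,2)` along `L × L'`. -/
def pullAlt22 (L L' : Spacetime →L[ℝ] Spacetime) : Alt22 →L[ℝ] Alt22 :=
  (mapValues 2 (Alt 2 ℝ) (Alt 2 ℝ) (pullAlt 2 ℝ L')).comp (pullAlt 2 (Alt 2 ℝ) L)

theorem pullAlt22_apply (L L' : Spacetime →L[ℝ] Spacetime) (α : Alt22) (u v : Fin 2 → Spacetime) :
    pullAlt22 L L' α u v = α (fun i => L (u i)) (fun i => L' (v i)) := rfl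

/-- Antisymmetrization, used only to prove that pullbacks of smooth forms are smooth. -/
def alternatizationCLM (k : ℕ) (W : Type*) [NormedAddCommGroup W] [NormedSpace ℝ W] :
    ContinuousMultilinearMap ℝ (fun _ : Fin k => Spacetime) W →L[ℝ] Alt k W :=
  LinearMap.mkContinuous
    { toFun := fun f => ContinuousMultilinearMap.alternatization f
      map_add' := map_add _
      map_smul' := fun c f => by
        ext v
        change ContinuousMultilinearMap.alternatization (c • f) v =
          c • ContinuousMultilinearMap.alternatization f v
        rw [ContinuousMultilinearMap.alternatization_apply_apply,
          ContinuousMultilinearMap.alternatization_apply_apply, Finset.smul_sum]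
        exact Finset.sum_congr rfl fun σ _ => smul_comm _ _ _ }
    (Fintype.card (Equiv.Perm (Fin k))) fun f => by
      refine ContinuousAlternatingMap.opNorm_le_bound _ (by positivity) fun v => ?_
      change ‖ContinuousMultilinearMap.alternatization f v‖ ≤ _
      rw [ContinuousMultilinearMap.alternatization_apply_apply]
      refine (norm_sum_le _ _).trans ?_
      have : ∀ σ ∈ (Finset.univ : Finset (Equiv.Perm (Fin k))),
          ‖Equiv.Perm.sign σ • f (v ∘ σ)‖ ≤ ‖f‖ * ∏ i, ‖v i‖ := by
        intro σ _
        have h1 : ‖Equiv.Perm.sign σ • f (v ∘ σ)‖ = ‖f (v ∘ σ)‖ := by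
          rcases Int.units_eq_one_or (Equiv.Perm.sign σ) with h | h <;> simp [h]
        rw [h1, ← Equiv.prod_comp σ]
        exact f.le_opNorm _
      refine (Finset.sum_le_sum this).trans (le_of_eq ?_)
      simp [mul_assoc]

theorem contDiff_pullAlt (k : ℕ) (W : Type*) [NormedAddCommGroup W] [NormedSpace ℝ W] :
    ContDiff ℝ ∞ (pullAlt k W) := by
  have h : pullAlt k W = fun L => ((k.factorial : ℝ)⁻¹) •
      ((alternatizationCLM k W).comp
        (ContinuousMultilinearMap.compContinuousLinearMapContinuousMultilinear ℝ
          (fun _ : Fin k => Spacetime) (fun _ => Spacetime) W (fun _ => L))).comp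
        (ContinuousAlternatingMap.toContinuousMultilinearMapCLM ℝ) := by
    funext L
    ext α v
    change _ = (k.factorial : ℝ)⁻¹ • ContinuousMultilinearMap.alternatization
      (((α.compContinuousLinearMap L)).toContinuousMultilinearMap) v
    rw [ContinuousMultilinearMap.alternatization_apply_apply]
    have : ∀ σ : Equiv.Perm (Fin k), Equiv.Perm.sign σ •
        α (fun i => L ((v ∘ σ) i)) = α (fun i => L (v i)) := by
      intro σ
      have := α.toAlternatingMap.map_perm (fun i => L (v i)) σ
      change α (fun i => L ((v ∘ σ) i)) = Equiv.Perm.sign σ • α (fun i => L (v i)) at this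
      rw [this, smul_smul]
      simp
    have h2 : ∑ σ : Equiv.Perm (Fin k), Equiv.Perm.sign σ • α (fun i => L ((v ∘ σ) i)) =
        (k.factorial : ℝ) • α (fun i => L (v i)) := by
      rw [Finset.sum_congr rfl fun σ _ => this σ]
      simp [Fintype.card_perm, Nat.cast_smul_eq_nsmul]
    change α (fun i => L (v i)) = (k.factorial : ℝ)⁻¹ •
      ∑ σ : Equiv.Perm (Fin k), Equiv.Perm.sign σ • α (fun i => L ((v ∘ σ) i))
    rw [h2, smul_smul, inv_mul_cancel₀ (by positivity), one_smul]
  rw [h]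
  have h3 : ContDiff ℝ ∞ fun L : Spacetime →L[ℝ] Spacetime =>
      ContinuousMultilinearMap.compContinuousLinearMapContinuousMultilinear ℝ
          (fun _ : Fin k => Spacetime) (fun _ => Spacetime) W (fun _ => L) :=
    (ContinuousMultilinearMap.contDiff _).comp (contDiff_pi.2 fun _ => contDiff_id)
  exact ContDiff.const_smul _ ((contDiff_const.clm_comp h3).clm_comp contDiff_const)

theorem contDiff_pullAlt22 :
    ContDiff ℝ ∞ fun L : (Spacetime →L[ℝ] Spacetime) × (Spacetime →L[ℝ] Spacetime) =>
      pullAlt22 L.1 L.2 := by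
  unfold pullAlt22
  have h1 : ContDiff ℝ ∞
      (mapValues 2 (Alt 2 ℝ) (Alt 2 ℝ)) := ContinuousLinearMap.contDiff _
  have h2 := h1.comp ((contDiff_pullAlt 2 ℝ).comp
    (contDiff_snd (E := Spacetime →L[ℝ] Spacetime) (F := Spacetime →L[ℝ] Spacetime)))
  exact h2.clm_comp ((contDiff_pullAlt 2 (Alt 2 ℝ)).comp contDiff_fst)

end FormPullback
/-! ### Diffeomorphisms -/

/-- The product `M × M` of two copies of an open subset of spacetime. -/
def double (M : Opens Spacetime) : Opens (Spacetime × Spacetime) :=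
  ⟨(M : Set Spacetime) ×ˢ (M : Set Spacetime), M.isOpen.prod M.isOpen⟩

/-- An orientation preserving diffeomorphism `N → M` (only the values of `toFun` on `N` and of
`invFun` on `M` matter). -/
structure OrientedDiffeo (N M : Opens Spacetime) where
  toFun : Spacetime → Spacetime
  invFun : Spacetime → Spacetime
  mapsTo : MapsTo toFun N M
  mapsTo_inv : MapsTo invFun M N
  left_inv : LeftInvOn invFun toFun N
  right_inv : RightInvOn invFun toFun M
  smooth : ContDiffOn ℝ ∞ toFun N
  smooth_inv : ContDiffOn ℝ ∞ invFun M
  det_pos : ∀ x ∈ N, 0 < (fderiv ℝ toFun x).det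

namespace OrientedDiffeo

variable {N M : Opens Spacetime} (φ : OrientedDiffeo N M)

theorem fderiv_comp_inv {y : Spacetime} (hy : y ∈ M) :
    (fderiv ℝ φ.toFun (φ.invFun y)).comp (fderiv ℝ φ.invFun y) = .id ℝ Spacetime := by
  have h1 : DifferentiableAt ℝ φ.invFun y :=
    (φ.smooth_inv.contDiffAt (M.isOpen.mem_nhds hy)).differentiableAt (by simp)
  have h2 : DifferentiableAt ℝ φ.toFun (φ.invFun y) :=
    (φ.smooth.contDiffAt (N.isOpen.mem_nhds (φ.mapsTo_inv hy))).differentiableAt (by simp)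
  rw [← fderiv_comp y h2 h1]
  have : φ.toFun ∘ φ.invFun =ᶠ[nhds y] id := by
    filter_upwards [M.isOpen.mem_nhds hy] with z hz using φ.right_inv hz
  rw [this.fderiv_eq, fderiv_id]

/-- The inverse diffeomorphism. -/
def symm : OrientedDiffeo M N where
  toFun := φ.invFun
  invFun := φ.toFun
  mapsTo := φ.mapsTo_inv
  mapsTo_inv := φ.mapsTo
  left_inv := φ.right_inv
  right_inv := φ.left_inv
  smooth := φ.smooth_inv
  smooth_inv := φ.smooth
  det_pos := fun y hy => by
    have h := congrArg ContinuousLinearMap.det (φ.fderiv_comp_inv hy)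
    have h1 : ((fderiv ℝ φ.toFun (φ.invFun y)).comp (fderiv ℝ φ.invFun y)).det =
        (fderiv ℝ φ.toFun (φ.invFun y)).det * (fderiv ℝ φ.invFun y).det :=
      LinearMap.det_comp _ _
    have h2 : (ContinuousLinearMap.id ℝ Spacetime).det = 1 := LinearMap.det_id
    rw [h1, h2] at h
    have h3 := φ.det_pos _ (φ.mapsTo_inv hy)
    exact pos_of_mul_pos_right (h ▸ one_pos) h3.le

theorem smooth_fderiv : ContDiffOn ℝ ∞ (fderiv ℝ φ.toFun) N :=
  φ.smooth.fderiv_of_isOpen N.isOpen (by simp)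

/-- A diffeomorphism as a proper map. -/
def toProper : ProperSmoothMap N M where
  toFun := φ.toFun
  smooth := φ.smooth
  mapsTo := φ.mapsTo
  proper := fun K hK hKM => by
    have : (N : Set Spacetime) ∩ φ.toFun ⁻¹' K = φ.invFun '' K := by
      ext x
      constructor
      · rintro ⟨hx, hxK⟩
        exact ⟨_, hxK, φ.left_inv hx⟩
      · rintro ⟨y, hy, rfl⟩
        exact ⟨φ.mapsTo_inv (hKM hy), by rw [mem_preimage, φ.right_inv (hKM hy)]; exact hy⟩
    rw [this]
    exact hK.image_of_continuousOn (φ.smooth_inv.continuousOn.mono hKM)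

/-- The diffeomorphism `φ_XY : (x, y) ↦ (φ(x), φ(y))` between the products. -/
def prodProper : ProperSmoothMap (double N) (double M) where
  toFun := Prod.map φ.toFun φ.toFun
  smooth := φ.smooth.prodMap φ.smooth
  mapsTo := fun _ hp => ⟨φ.mapsTo hp.1, φ.mapsTo hp.2⟩
  proper := fun K hK hKM => by
    have : ((double N : Opens _) : Set (Spacetime × Spacetime)) ∩
        Prod.map φ.toFun φ.toFun ⁻¹' K = Prod.map φ.invFun φ.invFun '' K := by
      ext x
      constructor
      · rintro ⟨hx, hxK⟩
        exact ⟨_, hxK, Prod.ext (φ.left_inv hx.1) (φ.left_inv hx.2)⟩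
      · rintro ⟨y, hy, rfl⟩
        refine ⟨⟨φ.mapsTo_inv (hKM hy).1, φ.mapsTo_inv (hKM hy).2⟩, ?_⟩
        have : Prod.map φ.toFun φ.toFun (Prod.map φ.invFun φ.invFun y) = y :=
          Prod.ext (φ.right_inv (hKM hy).1) (φ.right_inv (hKM hy).2)
        rw [mem_preimage, this]
        exact hy
    rw [this]
    exact hK.image_of_continuousOn
      ((φ.smooth_inv.prodMap φ.smooth_inv).continuousOn.mono hKM)

end OrientedDiffeo

/-- The diagonal map `γ : M → M × M`, `x ↦ (x, x)`. -/
def diagonal (M : Opens Spacetime) : ProperSmoothMap M (double M) where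
  toFun := fun x => (x, x)
  smooth := (contDiff_id.prodMk contDiff_id).contDiffOn
  mapsTo := fun _ hx => ⟨hx, hx⟩
  proper := fun K hK hKM => by
    have : (M : Set Spacetime) ∩ (fun x => (x, x)) ⁻¹' K =
        Prod.fst '' (K ∩ Set.diagonal Spacetime) := by
      ext x
      constructor
      · rintro ⟨_, hx⟩
        exact ⟨(x, x), ⟨hx, rfl⟩, rfl⟩
      · rintro ⟨⟨a, b⟩, ⟨hab, h⟩, rfl⟩
        obtain rfl : a = b := h
        exact ⟨(hKM hab).1, hab⟩
    rw [this]
    exact (hK.inter_right isClosed_diagonal).image continuous_fst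

/-! ### Smooth and distributional differential forms -/

/-- A smooth `k`-form on `M` (only the values on `M` matter). -/
structure SmoothForm (M : Opens Spacetime) (k : ℕ) where
  toFun : Spacetime → Alt k ℝ
  smooth : ContDiffOn ℝ ∞ toFun M

/-- Smooth `k`-forms with compact support in `M`. -/
abbrev TestForm (M : Opens Spacetime) (k : ℕ) := 𝓓(M, Alt k ℝ)

/-- Distributional differential forms on `M` of degree `4 - q`: a form `T` is the continuous
linear functional `ψ ↦ ∫_M ψ ∧ T` on test forms of degree `q`. -/
abbrev Current (M : Opens Spacetime) (q : ℕ) := TestForm M q →L[ℝ] ℝ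

/-- Smooth forms `¼ α_{abcd}(x,y) dxᵃ ∧ dxᵇ ∧ dyᶜ ∧ dyᵈ` with compact support in `M × M`. -/
abbrev TestKernel (M : Opens Spacetime) := 𝓓(double M, Alt22)

/-- Distributional kernels `κ = ¼ κ_{abcd}(x,y) dxᵃ ∧ dxᵇ ∧ dyᶜ ∧ dyᵈ` on `M × M`: `κ` is the
continuous linear functional `α ↦ ∫_{M × M} α ∧ κ` on test forms of bidegree `(2,2)`. -/
abbrev Kernel (M : Opens Spacetime) := TestKernel M →L[ℝ] ℝ

section

variable {N M : Opens Spacetime}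

/-- `φ^* ψ` for a test form `ψ`. -/
def pullTest (φ : OrientedDiffeo N M) (k : ℕ) : TestForm M k →L[ℝ] TestForm N k :=
  weightedComp φ.toProper (fun x => pullAlt k ℝ (fderiv ℝ φ.toFun x))
    ((contDiff_pullAlt k ℝ).comp_contDiffOn φ.smooth_fderiv)

/-- `φ_XY^* α` for a test kernel `α`. -/
def pullTestKernel (φ : OrientedDiffeo N M) : TestKernel M →L[ℝ] TestKernel N :=
  weightedComp φ.prodProper
    (fun p => pullAlt22 (fderiv ℝ φ.toFun p.1) (fderiv ℝ φ.toFun p.2))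
    (contDiff_pullAlt22.comp_contDiffOn
      ((φ.smooth_fderiv.comp contDiff_fst.contDiffOn fun _ hp => hp.1).prodMk
        (φ.smooth_fderiv.comp contDiff_snd.contDiffOn fun _ hp => hp.2)))

/-- `φ^* F` for a smooth form `F`. -/
def SmoothForm.pull {k : ℕ} (φ : OrientedDiffeo N M) (F : SmoothForm M k) : SmoothForm N k where
  toFun x := pullAlt k ℝ (fderiv ℝ φ.toFun x) (F.toFun (φ.toFun x))
  smooth := ((contDiff_pullAlt k ℝ).comp_contDiffOn φ.smooth_fderiv).clm_apply
    (F.smooth.comp φ.smooth φ.mapsTo)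

/-- `φ^* T` for a distributional form `T`: `∫_N ψ ∧ φ^* T = ∫_M (φ⁻¹)^* ψ ∧ T`. -/
def Current.pull {q : ℕ} (φ : OrientedDiffeo N M) (T : Current M q) : Current N q :=
  T.comp (pullTest φ.symm q)

/-- `φ_XY^* κ` for a distributional kernel `κ`:
`∫_{N × N} α ∧ φ_XY^* κ = ∫_{M × M} (φ_XY⁻¹)^* α ∧ κ`. -/
def Kernel.pullXY (φ : OrientedDiffeo N M) (κ : Kernel M) : Kernel N :=
  κ.comp (pullTestKernel φ.symm)

/-- The exterior derivative of test forms. -/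
def dTest (M : Opens Spacetime) (q : ℕ) : TestForm M q →L[ℝ] TestForm M (q + 1) :=
  (TestFunction.postcompCLM
    (ContinuousAlternatingMap.alternatizeUncurryFinCLM (n := q) ℝ Spacetime ℝ)).comp
    (TestFunction.fderivCLM ℝ ⊤ ⊤)

theorem dTest_apply (q : ℕ) (ψ : TestForm M q) (x : Spacetime) :
    dTest M q ψ x = extDeriv ψ x := by
  change ContinuousAlternatingMap.alternatizeUncurryFinCLM ℝ Spacetime ℝ
    (TestFunction.fderivCLM ℝ ⊤ ⊤ ψ x) = _
  rw [TestFunction.fderivCLM_apply_of_le ψ (by simp)]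
  rfl

/-- The exterior derivative of a distributional form of degree `3 - q`:
`∫ ψ ∧ dT = (-1)^{q+1} ∫ dψ ∧ T` for test forms `ψ` of degree `q`. -/
def Current.d {q : ℕ} (T : Current M (q + 1)) : Current M q :=
  ((-1 : ℝ) ^ (q + 1)) • T.comp (dTest M q)

/-- `⋆T` for a distributional 2-form `T`: `∫ ψ ∧ ⋆T = ∫ ⋆ψ ∧ T`. -/
def Current.starTwo (c : ℝ) (T : Current M 2) : Current M 2 :=
  T.comp (TestFunction.postcompCLM (star₂ c))

/-- `⋆J` for a distributional 1-form `J`: `∫ ψ ∧ ⋆J = ∫ J ∧ ⋆ψ = -∫ ⋆ψ ∧ J` for test 1-forms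
`ψ`. -/
def Current.starOne (c : ℝ) (J : Current M 3) : Current M 1 :=
  -J.comp (TestFunction.postcompCLM (star₁ c))

/-- `⋆⁻¹T` for a distributional 3-form `T`: `∫ ψ ∧ ⋆⁻¹T = -∫ ⋆ψ ∧ T` for test 3-forms `ψ`. -/
def Current.starThreeInv (c : ℝ) (T : Current M 1) : Current M 3 :=
  -T.comp (TestFunction.postcompCLM (star₃ c))

/-- `⋆_X κ`, the Hodge dual in the `x` directions: `∫ α ∧ ⋆_X κ = ∫ ⋆_X α ∧ κ`. -/
def Kernel.starX (c : ℝ) (κ : Kernel M) : Kernel M :=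
  κ.comp (TestFunction.postcompCLM (star₂ c))

/-- `⋆_X⁻¹ κ = -⋆_X κ`. -/
def Kernel.starXInv (c : ℝ) (κ : Kernel M) : Kernel M := -κ.starX c

/-- `α ↦ ¼ ε^{abcd} α_{abcd}`, the coefficient of `dx⁰ ∧ dx¹ ∧ dx² ∧ dx³` in the restriction of
`¼ α_{abcd} dxᵃ ∧ dxᵇ ∧ dyᶜ ∧ dyᵈ` to the diagonal. -/
def diagTop : Alt22 →L[ℝ] ℝ :=
  (1 / 4 : ℝ) • ∑ σ : Equiv.Perm (Fin 4), ((Equiv.Perm.sign σ : ℤ) : ℝ) •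
    (ContinuousAlternatingMap.apply ℝ Spacetime ℝ ![coordVec (σ 2), coordVec (σ 3)]).comp
      (ContinuousAlternatingMap.apply ℝ Spacetime (Alt 2 ℝ) ![coordVec (σ 0), coordVec (σ 1)])

/-- The form `π_X^* α ∧ π_Y^* β` of bidegree `(2,2)`. -/
def tensor : Alt 2 ℝ →L[ℝ] Alt 2 ℝ →L[ℝ] Alt22 := tensorL 2 (Alt 2 ℝ)

theorem tensor_apply (α β : Alt 2 ℝ) (u v : Fin 2 → Spacetime) :
    tensor α β u v = α u * β v := rfl

/-- The coefficient `¼ ε^{abcd} α_{ab} β_{cd}` of `α ∧ β`. -/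
def topWedge : Alt 2 ℝ →L[ℝ] Alt 2 ℝ →L[ℝ] ℝ :=
  (ContinuousLinearMap.compL ℝ (Alt 2 ℝ) Alt22 ℝ diagTop).comp tensor

/-- A smooth 2-form as a distributional form, `ψ ↦ ∫_M ψ ∧ F`. -/
def Current.ofForm (F : SmoothForm M 2) : Current M 2 :=
  TestFunction.integralAgainstBilinCLM topWedge MeasureTheory.volume F.toFun

/-- The kernel `Δ = ¼ ε_{abcd} δ⁴(x - y) dxᵃ ∧ dxᵇ ∧ dyᶜ ∧ dyᵈ`, i.e.
`∫_{M × M} α ∧ Δ = ∫_M γ^* α` with `γ : x ↦ (x, x)`. -/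
def Kernel.delta (M : Opens Spacetime) : Kernel M :=
  (TestFunction.integralAgainstBilinCLM (ContinuousLinearMap.mul ℝ ℝ) MeasureTheory.volume
    (fun _ : Spacetime => (1 : ℝ))).comp
    (weightedComp (diagonal M) (fun _ => diagTop) contDiffOn_const)

/-! ### The constitutive relation -/

/-- The identity map as a proper map. -/
def idProper (M : Opens Spacetime) : ProperSmoothMap M M where
  toFun := id
  smooth := contDiffOn_id
  mapsTo := fun _ h => h
  proper := fun K hK hKM => by
    rw [preimage_id, inter_eq_self_of_subset_right hKM]
    exact hK

/-- `χ F`, for a test function `χ` and a smooth form `F`. -/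
def SmoothForm.cutoff {k : ℕ} (F : SmoothForm M k) (χ : 𝓓(M, ℝ)) : TestForm M k :=
  weightedComp (F := ℝ) (F' := Alt k ℝ) (idProper M)
    (fun x => lineMap (Alt k ℝ) (F.toFun x)) ((contDiff_lineMap _).comp_contDiffOn F.smooth) χ

theorem SmoothForm.cutoff_apply {k : ℕ} (F : SmoothForm M k) (χ : 𝓓(M, ℝ)) {x : Spacetime}
    (hx : x ∈ M) : F.cutoff χ x = χ x • F.toFun x :=
  weightedComp_apply (F := ℝ) (F' := Alt k ℝ) (idProper M) _ _ χ hx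

/-- The test kernel `π_X^* ψ ∧ π_Y^* η`. -/
def tensorTest (ψ η : TestForm M 2) : TestKernel M where
  toFun p := tensor (ψ p.1) (η p.2)
  contDiff' := by
    have h : ContDiff ℝ ∞ tensor := contDiff_tensorL 2 (Alt 2 ℝ)
    exact (h.comp (ψ.contDiff.comp contDiff_fst)).clm_apply (η.contDiff.comp contDiff_snd)
  hasCompactSupport' := HasCompactSupport.intro
    (ψ.hasCompactSupport.isCompact.prod η.hasCompactSupport.isCompact) fun p hp => by
      by_cases h : p.1 ∈ tsupport ψ
      · rw [image_eq_zero_of_notMem_tsupport (f := η) fun h' => hp ⟨h, h'⟩, map_zero]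
      · rw [image_eq_zero_of_notMem_tsupport (f := ψ) h, map_zero]
        rfl
  tsupport_subset' := by
    have hK := ψ.hasCompactSupport.isCompact.prod η.hasCompactSupport.isCompact
    refine (closure_minimal (fun p hp => ?_) hK.isClosed).trans
      (prod_mono ψ.tsupport_subset η.tsupport_subset)
    by_contra hp'
    refine hp ?_
    change tensor (ψ p.1) (η p.2) = 0
    by_cases h : p.1 ∈ tsupport ψ
    · rw [image_eq_zero_of_notMem_tsupport (f := η) fun h' => hp' ⟨h, h'⟩, map_zero]
    · rw [image_eq_zero_of_notMem_tsupport (f := ψ) h, map_zero]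
      rfl

/-- `P = ∫_Y κ ∧ π_Y^* F`, i.e. `P_{ab}(x) = ¼ ε^{cdef} ∫ κ_{abcd}(x,y) F_{ef}(y) d⁴y`, for a
distributional kernel `κ`: for every test form `ψ`, the number
`∫_M ψ ∧ P = ∫_{M × M} π_X^* ψ ∧ π_Y^* F ∧ κ` is the limit of
`∫_{M × M} π_X^* ψ ∧ π_Y^* (χ F) ∧ κ` as the smooth cutoffs `0 ≤ χ ≤ 1` with compact support in
`M` become `1` on larger and larger compact subsets of `M`. (All forms here have even degree in
each of `x` and `y`, so their order is immaterial.) -/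
def IsKernelIntegral (κ : Kernel M) (F : SmoothForm M 2) (P : Current M 2) : Prop :=
  ∀ ψ : TestForm M 2, ∀ ε > 0, ∃ K : Set Spacetime, IsCompact K ∧ K ⊆ M ∧
    ∀ χ : 𝓓(M, ℝ), (∀ x, 0 ≤ χ x ∧ χ x ≤ 1) → (∀ x ∈ K, χ x = 1) →
      |κ (tensorTest ψ (F.cutoff χ)) - P ψ| < ε

/-- `Ẑ_X⁻¹ α = ⋆_X⁻¹ φ_XY^* ⋆_X (φ_XY⁻¹)^* α`, with the Hodge duals of the Minkowski metrics on
both sides. -/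
def ZXInv (c : ℝ) (φ : OrientedDiffeo N M) (α : Kernel N) : Kernel N :=
  (((α.pullXY φ.symm).starX c).pullXY φ).starXInv c

/-- The transformed kernel `κ̂ = Ẑ_X⁻¹ φ_XY^* (ε₀ Δ + κ) - ε₀ Δ̂`. -/
def kappaHat (c ε₀ : ℝ) (φ : OrientedDiffeo N M) (κ : Kernel M) : Kernel N :=
  ZXInv c φ ((ε₀ • Kernel.delta M + κ).pullXY φ) - ε₀ • Kernel.delta N

/-! ### Maxwell's equations -/

/-- `dF = 0` on `M`. -/
def SmoothForm.Closed {k : ℕ} (F : SmoothForm M k) : Prop :=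
  ∀ x ∈ M, extDeriv F.toFun x = 0

/-- `d ⋆(ε₀ F + P) = c⁻² ⋆J` on `M` for a distributional polarization `P` and current `J`. -/
def MaxwellDist (c ε₀ : ℝ) (F : SmoothForm M 2) (P : Current M 2) (J : Current M 3) : Prop :=
  (Current.starTwo c (ε₀ • Current.ofForm F + P)).d = (c ^ 2)⁻¹ • Current.starOne c J

/-- `d ⋆(ε₀ F + P) = c⁻² ⋆J` on `M` for a smooth polarization `P` and current `J`. -/
def MaxwellSmooth (c ε₀ : ℝ) (F P : SmoothForm M 2) (J : SmoothForm M 1) : Prop :=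
  ∀ x ∈ M, extDeriv (fun y => star₂ c (ε₀ • F.toFun y + P.toFun y)) x =
    (c ^ 2)⁻¹ • star₁ c (J.toFun x)

/-- The transformed current `⋆⁻¹ φ^* ⋆J` of a distributional 1-form `J`. -/
def Current.transformed (c : ℝ) (φ : OrientedDiffeo N M) (J : Current M 3) : Current N 3 :=
  ((J.starOne c).pull φ).starThreeInv c

/-- The transformed current `⋆⁻¹ φ^* ⋆J` of a smooth 1-form `J` (`⋆⁻¹ = ⋆` on 3-forms). -/
def SmoothForm.transformed (c : ℝ) (φ : OrientedDiffeo N M) (J : SmoothForm M 1) :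
    SmoothForm N 1 where
  toFun x := star₃ c (pullAlt 3 ℝ (fderiv ℝ φ.toFun x) (star₁ c (J.toFun (φ.toFun x))))
  smooth := by
    have h3 : ContDiff ℝ ∞ (star₃ (W := ℝ) c) := ContinuousLinearMap.contDiff _
    have h1 : ContDiff ℝ ∞ (star₁ (W := ℝ) c) := ContinuousLinearMap.contDiff _
    exact h3.comp_contDiffOn
      (((contDiff_pullAlt 3 ℝ).comp_contDiffOn φ.smooth_fderiv).clm_apply
        (h1.comp_contDiffOn (J.smooth.comp φ.smooth φ.mapsTo)))

end
end SpacetimeOptics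

end

open SpacetimeOptics

/-!
The transformed kernel is designed so that the excitation `G = ⋆(ε₀ F + Π)` is carried to its
pullback `φ^* G`; Maxwell's equations then follow because `d` commutes with pullbacks.

Unfolding the duality definitions, `φ_XY^*` cancels against `(φ_XY⁻¹)^*`, and `κ̂` evaluated on
`π_X^* ψ ∧ π_Y^* (χ F̂)` equals
`-(ε₀ Δ + κ)(π_X^* (⋆ (φ⁻¹)^* ⋆ψ) ∧ π_Y^* ((χ ∘ φ⁻¹) F)) - ε₀ Δ̂(π_X^* ψ ∧ π_Y^* (χ F̂))`.
If `χ` exhausts the domain `N` of `φ`, then `χ ∘ φ⁻¹` exhausts `M`, so the limit exists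
(`IsKernelIntegral.transform`). As `Δ` and `Δ̂` reproduce `F` and `F̂` (`isKernelIntegral_delta`),
it is `Π̂ = ⋆⁻¹ φ^* ⋆(ε₀ F + Π) - ε₀ F̂` (`isKernelIntegral_kappaHat`). It is unique because every
compact set admits a cutoff (`exists_cutoff`).

Since `⋆⋆ = -1` on 2-forms, `⋆(ε₀ F̂ + Π̂) = φ^* ⋆(ε₀ F + Π)` (`starTwo_hatPolarization`), whose
exterior derivative is `c⁻² φ^* ⋆J = c⁻² ⋆Ĵ`. For smooth data the same formula defines a smooth
`Π̂`. It represents the distributional one (`ofForm_hatPolarization`) because `⋆` is symmetric for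
the wedge pairing (`topWedge_star₂`) and because integration of 4-forms is invariant under
orientation preserving diffeomorphisms (`ofForm_pull`, from `topWedge_pullAlt` and the change of
variables formula).
-/

namespace SpacetimeOptics

/-! ### Linear algebra of forms on Minkowski spacetime -/

theorem eq_vec_of_fin_two (v : Fin 2 → Spacetime) : v = ![v 0, v 1] := by
  ext j; fin_cases j <;> rfl

theorem eq_vec_of_fin_three (v : Fin 3 → Spacetime) : v = ![v 0, v 1, v 2] := by
  ext j; fin_cases j <;> rfl

/-- Alternating 3-forms agree as soon as they agree on increasing triples of coordinate vectors. -/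
theorem alt3_ext_of_lt {W : Type*} [NormedAddCommGroup W] [NormedSpace ℝ W] {α β : Alt 3 W}
    (h : ∀ p q r : Fin 4, p < q → q < r →
      α ![coordVec p, coordVec q, coordVec r] = β ![coordVec p, coordVec q, coordVec r]) :
    α = β := by
  apply ext_coord
  intro i hi
  rw [eq_vec_of_fin_three fun j => coordVec (i j)]
  have h01 : i 0 ≠ i 1 := fun h => by simpa using hi h
  have h02 : i 0 ≠ i 2 := fun h => by simpa using hi h
  have h12 : i 1 ≠ i 2 := fun h => by simpa using hi h
  generalize i 0 = p at *
  generalize i 1 = q at *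
  generalize i 2 = r at *
  rcases lt_or_gt_of_ne h01 with a | a <;> rcases lt_or_gt_of_ne h12 with b | b <;>
    rcases lt_or_gt_of_ne h02 with d | d
  · exact h _ _ _ a b
  · exact absurd (a.trans b) d.not_gt
  · rw [alt3_swap12, alt3_swap12 β, h _ _ _ d b]
  · rw [alt3_swap12, alt3_swap01, alt3_swap12 β, alt3_swap01 β, h _ _ _ d a]
  · rw [alt3_swap01, alt3_swap01 β, h _ _ _ a d]
  · rw [alt3_swap01, alt3_swap12, alt3_swap01 β, alt3_swap12 β, h _ _ _ b d]
  · exact absurd (b.trans a) d.not_gt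
  · rw [alt3_swap01, alt3_swap12, alt3_swap01, alt3_swap01 β, alt3_swap12 β, alt3_swap01 β,
      h _ _ _ b a]

/-- `⋆⋆ = 1` on 3-forms. -/
theorem star₁_star₃ {W : Type*} [NormedAddCommGroup W] [NormedSpace ℝ W] {c : ℝ} (hc : c ≠ 0)
    (α : Alt 3 W) : star₁ c (star₃ c α) = α := by
  obtain ⟨h1, h2, h3, h4⟩ := star₁_coord c (star₃ c α)
  obtain ⟨k1, k2, k3, k4⟩ := star₃_coord c α
  have hcc : (c ^ 2)⁻¹ * c * c = 1 := by field_simp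
  rw [k1, smul_smul, show -(c ^ 2)⁻¹ * c * -c = 1 by linear_combination hcc, one_smul] at h1
  rw [k2, smul_smul, show -c * (-(c ^ 2)⁻¹ * c) = 1 by linear_combination hcc, one_smul] at h2
  rw [k3, smul_smul, show c * ((c ^ 2)⁻¹ * c) = 1 by linear_combination hcc, one_smul] at h3
  rw [k4, smul_smul, show -c * (-(c ^ 2)⁻¹ * c) = 1 by linear_combination hcc, one_smul] at h4
  refine alt3_ext_of_lt fun p q r hpq hqr => ?_
  fin_cases p <;> fin_cases q <;> first | exact absurd hpq (by decide) | skip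
  all_goals fin_cases r <;> first | exact absurd hqr (by decide) | skip
  exacts [h4, h3, h2, h1]

theorem topWedge_apply (α β : Alt 2 ℝ) : topWedge α β =
    (1 / 4 : ℝ) * ∑ σ : Equiv.Perm (Fin 4), ((Equiv.Perm.sign σ : ℤ) : ℝ) *
      (α ![coordVec (σ 0), coordVec (σ 1)] * β ![coordVec (σ 2), coordVec (σ 3)]) := by
  change diagTop (tensor α β) = _
  simp [diagTop, tensor_apply]

open Equiv.Perm in
set_option maxHeartbeats 1000000 in
/-- The coefficient of `α ∧ β` in terms of the six components of each form. -/
theorem topWedge_eq (α β : Alt 2 ℝ) : topWedge α β =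
    α ![coordVec 0, coordVec 1] * β ![coordVec 2, coordVec 3]
    - α ![coordVec 0, coordVec 2] * β ![coordVec 1, coordVec 3]
    + α ![coordVec 0, coordVec 3] * β ![coordVec 1, coordVec 2]
    + α ![coordVec 1, coordVec 2] * β ![coordVec 0, coordVec 3]
    - α ![coordVec 1, coordVec 3] * β ![coordVec 0, coordVec 2]
    + α ![coordVec 2, coordVec 3] * β ![coordVec 0, coordVec 1] := by
  -- The sum over the 24 permutations is expanded by recursion on the image of `0`.
  have sum_perm_succ (n : ℕ) (f : Equiv.Perm (Fin (n + 1)) → ℝ) :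
      ∑ σ, f σ = ∑ p, ∑ τ, f (decomposeFin.symm (p, τ)) := by
    rw [← Equiv.sum_comp decomposeFin.symm, Fintype.sum_prod_type]
  have a1 (p : Fin 4) (τ) : decomposeFin.symm (p, τ) 1 = Equiv.swap 0 p (τ 0).succ :=
    decomposeFin_symm_apply_succ τ p 0
  have a2 (p : Fin 4) (τ) : decomposeFin.symm (p, τ) 2 = Equiv.swap 0 p (τ 1).succ :=
    decomposeFin_symm_apply_succ τ p 1
  have a3 (p : Fin 4) (τ) : decomposeFin.symm (p, τ) 3 = Equiv.swap 0 p (τ 2).succ :=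
    decomposeFin_symm_apply_succ τ p 2
  have b1 (p : Fin 3) (τ) : decomposeFin.symm (p, τ) 1 = Equiv.swap 0 p (τ 0).succ :=
    decomposeFin_symm_apply_succ τ p 0
  have b2 (p : Fin 3) (τ) : decomposeFin.symm (p, τ) 2 = Equiv.swap 0 p (τ 1).succ :=
    decomposeFin_symm_apply_succ τ p 1
  have c1 (p : Fin 2) (τ) : decomposeFin.symm (p, τ) 1 = Equiv.swap 0 p (τ 0).succ :=
    decomposeFin_symm_apply_succ τ p 0
  have hs (γ : Alt 2 ℝ) (a b : Fin 4) := alt2_swap γ (coordVec a) (coordVec b)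
  rw [topWedge_apply]
  simp only [sum_perm_succ, Fin.sum_univ_four, Fin.sum_univ_three, Fin.sum_univ_two,
    decomposeFin.symm_sign, Equiv.swap_apply_def, a1, a2, a3, b1, b2, c1]
  simp [hs _ 1 0, hs _ 2 0, hs _ 3 0, hs _ 2 1, hs _ 3 1, hs _ 3 2]
  ring

/-- The Hodge dual is symmetric for the wedge pairing of 2-forms: `⋆α ∧ β = α ∧ ⋆β`. -/
theorem topWedge_star₂ (c : ℝ) (α β : Alt 2 ℝ) :
    topWedge (star₂ c α) β = topWedge α (star₂ c β) := by
  obtain ⟨h1, h2, h3, h4, h5, h6⟩ := star₂_coord c α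
  obtain ⟨k1, k2, k3, k4, k5, k6⟩ := star₂_coord c β
  rw [topWedge_eq, topWedge_eq, h1, h2, h3, h4, h5, h6, k1, k2, k3, k4, k5, k6]
  simp only [smul_eq_mul]
  ring

/-- The wedge pairing of 2-forms is a density: `L^*α ∧ L^*β = det L • α ∧ β`. -/
theorem topWedge_pullAlt (L : Spacetime →L[ℝ] Spacetime) (α β : Alt 2 ℝ) :
    topWedge (pullAlt 2 ℝ L α) (pullAlt 2 ℝ L β) = L.det * topWedge α β := by
  -- `τ v = ∑ σ, sign σ α(v_{σ0}, v_{σ1}) β(v_{σ2}, v_{σ3})` is an alternating form of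
  -- top degree, hence a multiple of the determinant.
  let m : MultilinearMap ℝ (fun _ : Fin 4 => Spacetime) ℝ :=
    (TensorProduct.lid ℝ ℝ).toLinearMap.compMultilinearMap
      ((α.toMultilinearMap.domCoprod β.toMultilinearMap).domDomCongr
        (finSumFinEquiv (m := 2) (n := 2)))
  let τ : AlternatingMap ℝ Spacetime ℝ (Fin 4) := MultilinearMap.alternatization m
  have hm (v : Fin 4 → Spacetime) : m v = α ![v 0, v 1] * β ![v 2, v 3] := by
    have : m v = α (fun i => v (finSumFinEquiv (m := 2) (n := 2) (Sum.inl i))) *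
        β (fun i => v (finSumFinEquiv (m := 2) (n := 2) (Sum.inr i))) := rfl
    rw [this, eq_vec_of_fin_two fun i => v (finSumFinEquiv (m := 2) (n := 2) (Sum.inl i)),
      eq_vec_of_fin_two fun i => v (finSumFinEquiv (m := 2) (n := 2) (Sum.inr i))]
    rfl
  have hτ (v : Fin 4 → Spacetime) : τ v = ∑ σ : Equiv.Perm (Fin 4),
      ((Equiv.Perm.sign σ : ℤ) : ℝ) * (α ![v (σ 0), v (σ 1)] * β ![v (σ 2), v (σ 3)]) := by
    change MultilinearMap.alternatization m v = _
    rw [MultilinearMap.alternatization_apply]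
    refine Finset.sum_congr rfl fun σ _ => ?_
    rw [MultilinearMap.domDomCongr_apply, hm, Units.smul_def, zsmul_eq_mul]
  have h1 : topWedge α β = (1 / 4 : ℝ) * τ coordVec := by rw [topWedge_apply, hτ]
  have h2 : topWedge (pullAlt 2 ℝ L α) (pullAlt 2 ℝ L β) =
      (1 / 4 : ℝ) * τ fun i => L (coordVec i) := by
    rw [topWedge_apply, hτ]
    congr 1
    refine Finset.sum_congr rfl fun σ _ => ?_
    change _ * (α (fun i => L (_)) * β (fun i => L (_))) = _
    rw [eq_vec_of_fin_two fun i : Fin 2 => L (![coordVec (σ 0), coordVec (σ 1)] i),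
      eq_vec_of_fin_two fun i : Fin 2 => L (![coordVec (σ 2), coordVec (σ 3)] i)]
    rfl
  have h3 : (τ fun i => L (coordVec i)) = L.det * τ coordVec := by
    have e : ∀ i, Pi.basisFun ℝ (Fin 4) i = coordVec i := fun i => by simp [coordVec]
    have e' : (Pi.basisFun ℝ (Fin 4) : Fin 4 → Spacetime) = coordVec := funext e
    have h := τ.eq_smul_basis_det (Pi.basisFun ℝ (Fin 4))
    have h4 := (Pi.basisFun ℝ (Fin 4)).det_comp (L : Spacetime →ₗ[ℝ] Spacetime) coordVec
    rw [← e', Module.Basis.det_self, mul_one, e'] at h4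
    rw [h, AlternatingMap.smul_apply, AlternatingMap.smul_apply, e', ← e',
      Module.Basis.det_self, e', smul_eq_mul, smul_eq_mul, mul_one, mul_comm]
    congr 1
  rw [h1, h2, h3]
  ring

/-! ### Pullback of test forms and test kernels -/

theorem TestFunction.ext_of_mem {E F : Type*} [NormedAddCommGroup E] [NormedSpace ℝ E]
    [NormedAddCommGroup F] [NormedSpace ℝ F] {Ω : Opens E} {f g : 𝓓(Ω, F)}
    (h : ∀ x ∈ Ω, f x = g x) : f = g := by
  ext x
  by_cases hx : x ∈ Ω
  · exact h x hx
  · rw [image_eq_zero_of_notMem_tsupport fun h' => hx (f.tsupport_subset h'),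
      image_eq_zero_of_notMem_tsupport fun h' => hx (g.tsupport_subset h')]

variable {N M : Opens Spacetime}

theorem OrientedDiffeo.inv_fderiv_comp (φ : OrientedDiffeo N M) {x : Spacetime} (hx : x ∈ N) :
    (fderiv ℝ φ.invFun (φ.toFun x)).comp (fderiv ℝ φ.toFun x) = .id ℝ Spacetime :=
  φ.symm.fderiv_comp_inv hx

theorem pullAlt_pullAlt_of_comp_eq_id (k : ℕ) {W : Type*} [NormedAddCommGroup W]
    [NormedSpace ℝ W] {L L' : Spacetime →L[ℝ] Spacetime} (h : L'.comp L = .id ℝ Spacetime)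
    (α : Alt k W) : pullAlt k W L (pullAlt k W L' α) = α := by
  ext v
  change α (fun i => (L'.comp L) (v i)) = α v
  rw [h]
  rfl

theorem pullAlt22_tensor (L L' : Spacetime →L[ℝ] Spacetime) (α β : Alt 2 ℝ) :
    pullAlt22 L L' (tensor α β) = tensor (pullAlt 2 ℝ L α) (pullAlt 2 ℝ L' β) := rfl

theorem star₂_tensor (c : ℝ) (α β : Alt 2 ℝ) :
    star₂ c (tensor α β) = tensor (star₂ c α) β := by
  ext u v
  rw [tensor_apply, eq_vec_of_fin_two u, star₂_apply, star₂_apply]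
  simp [tensor_apply, Finset.sum_mul, mul_assoc]

theorem pullTest_apply (φ : OrientedDiffeo N M) {k : ℕ} (ψ : TestForm M k) {x : Spacetime}
    (hx : x ∈ N) :
    pullTest φ k ψ x = pullAlt k ℝ (fderiv ℝ φ.toFun x) (ψ (φ.toFun x)) :=
  weightedComp_apply φ.toProper _ _ ψ hx

theorem pullTestKernel_apply (φ : OrientedDiffeo N M) (α : TestKernel M)
    {p : Spacetime × Spacetime} (hp : p ∈ double N) :
    pullTestKernel φ α p = pullAlt22 (fderiv ℝ φ.toFun p.1) (fderiv ℝ φ.toFun p.2)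
      (α (φ.toFun p.1, φ.toFun p.2)) :=
  weightedComp_apply φ.prodProper _ _ α hp

theorem pullTestKernel_symm_pullTestKernel (φ : OrientedDiffeo N M) (α : TestKernel M) :
    pullTestKernel φ.symm (pullTestKernel φ α) = α := by
  refine TestFunction.ext_of_mem fun p hp => ?_
  rw [pullTestKernel_apply _ _ hp,
    pullTestKernel_apply φ α (p := (φ.symm.toFun p.1, φ.symm.toFun p.2))
      ⟨φ.mapsTo_inv hp.1, φ.mapsTo_inv hp.2⟩]
  have h1 : φ.toFun (φ.symm.toFun p.1) = p.1 := φ.right_inv hp.1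
  have h2 : φ.toFun (φ.symm.toFun p.2) = p.2 := φ.right_inv hp.2
  ext u v
  simp only [pullAlt22_apply, h1, h2]
  have e1 (w : Spacetime) : fderiv ℝ φ.toFun (φ.symm.toFun p.1) (fderiv ℝ φ.symm.toFun p.1 w) = w :=
    congrArg (fun L => L w) (φ.fderiv_comp_inv hp.1)
  have e2 (w : Spacetime) : fderiv ℝ φ.toFun (φ.symm.toFun p.2) (fderiv ℝ φ.symm.toFun p.2 w) = w :=
    congrArg (fun L => L w) (φ.fderiv_comp_inv hp.2)
  simp only [e1, e2]

theorem tensorTest_apply (ψ η : TestForm M 2) (p : Spacetime × Spacetime) :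
    tensorTest ψ η p = tensor (ψ p.1) (η p.2) := rfl

theorem pullTestKernel_tensorTest (φ : OrientedDiffeo N M) (ψ η : TestForm M 2) :
    pullTestKernel φ (tensorTest ψ η) = tensorTest (pullTest φ 2 ψ) (pullTest φ 2 η) := by
  refine TestFunction.ext_of_mem fun p hp => ?_
  rw [pullTestKernel_apply _ _ hp, tensorTest_apply, tensorTest_apply, pullTest_apply _ _ hp.1,
    pullTest_apply _ _ hp.2, pullAlt22_tensor]

theorem postcompCLM_star₂_tensorTest (c : ℝ) (ψ η : TestForm M 2) :
    TestFunction.postcompCLM (star₂ c) (tensorTest ψ η) =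
      tensorTest (TestFunction.postcompCLM (star₂ c) ψ) η := by
  ext1 p
  exact star₂_tensor c (ψ p.1) (η p.2)

/-- `χ ∘ φ` for a scalar test function `χ`. -/
noncomputable def pullScalar (φ : OrientedDiffeo N M) : 𝓓(M, ℝ) →L[ℝ] 𝓓(N, ℝ) :=
  weightedComp φ.toProper (fun _ => ContinuousLinearMap.id ℝ ℝ) contDiffOn_const

theorem pullScalar_apply (φ : OrientedDiffeo N M) (χ : 𝓓(M, ℝ)) {x : Spacetime} (hx : x ∈ N) :
    pullScalar φ χ x = χ (φ.toFun x) :=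
  weightedComp_apply (F := ℝ) (F' := ℝ) φ.toProper _ _ χ hx

theorem pullScalar_mem_Icc (φ : OrientedDiffeo N M) {χ : 𝓓(M, ℝ)}
    (hχ : ∀ x, 0 ≤ χ x ∧ χ x ≤ 1) (x : Spacetime) :
    0 ≤ pullScalar φ χ x ∧ pullScalar φ χ x ≤ 1 := by
  by_cases hx : x ∈ N
  · rw [pullScalar_apply _ _ hx]
    exact hχ _
  · rw [image_eq_zero_of_notMem_tsupport fun h => hx ((pullScalar φ χ).tsupport_subset h)]
    exact ⟨le_rfl, zero_le_one⟩

theorem pullTest_symm_cutoff_pull (φ : OrientedDiffeo N M) {k : ℕ} (F : SmoothForm M k)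
    (χ : 𝓓(N, ℝ)) :
    pullTest φ.symm k ((F.pull φ).cutoff χ) = F.cutoff (pullScalar φ.symm χ) := by
  refine TestFunction.ext_of_mem fun y hy => ?_
  have hy' : φ.symm.toFun y ∈ N := φ.mapsTo_inv hy
  have h1 : φ.toFun (φ.symm.toFun y) = y := φ.right_inv hy
  rw [pullTest_apply _ _ hy, SmoothForm.cutoff_apply _ _ hy', SmoothForm.cutoff_apply _ _ hy,
    pullScalar_apply _ _ hy, map_smul]
  congr 1
  change pullAlt k ℝ _ (pullAlt k ℝ _ (F.toFun (φ.toFun (φ.symm.toFun y)))) = _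
  rw [h1]
  exact pullAlt_pullAlt_of_comp_eq_id k (φ.fderiv_comp_inv hy) _

/-- The exterior derivative commutes with the pullback of forms that are smooth on an open set. -/
theorem extDeriv_pullAlt (φ : OrientedDiffeo N M) {k : ℕ} {η : Spacetime → Alt k ℝ}
    (hη : ContDiffOn ℝ ∞ η M) {x : Spacetime} (hx : x ∈ N) :
    extDeriv (fun y => pullAlt k ℝ (fderiv ℝ φ.toFun y) (η (φ.toFun y))) x =
      pullAlt (k + 1) ℝ (fderiv ℝ φ.toFun x) (extDeriv η (φ.toFun x)) :=
  extDeriv_pullback (r := ∞)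
    ((hη.contDiffAt (M.isOpen.mem_nhds (φ.mapsTo hx))).differentiableAt (by simp))
    (φ.smooth.contDiffAt (N.isOpen.mem_nhds hx)) (by
      rw [minSmoothness_of_isRCLikeNormedField]
      exact WithTop.coe_le_coe.2 le_top)

theorem dTest_pullTest (φ : OrientedDiffeo N M) {q : ℕ} (ψ : TestForm M q) :
    dTest N q (pullTest φ q ψ) = pullTest φ (q + 1) (dTest M q ψ) := by
  refine TestFunction.ext_of_mem fun x hx => ?_
  rw [dTest_apply, pullTest_apply _ _ hx, dTest_apply,
    ← extDeriv_pullAlt φ ψ.contDiff.contDiffOn hx]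
  refine Filter.EventuallyEq.extDeriv_eq ?_
  filter_upwards [N.isOpen.mem_nhds hx] with y hy using pullTest_apply φ ψ hy

/-- A compact subset of `M` carries a smooth cutoff `0 ≤ χ ≤ 1` with compact support in `M` that
equals `1` on it. -/
theorem exists_cutoff {K : Set Spacetime} (hK : IsCompact K) (hKM : K ⊆ M) :
    ∃ χ : 𝓓(M, ℝ), (∀ x, 0 ≤ χ x ∧ χ x ≤ 1) ∧ ∀ x ∈ K, χ x = 1 := by
  obtain ⟨K', hK', hKK', hK'M⟩ := exists_compact_between hK M.isOpen hKM
  obtain ⟨f, hf1, hf0, hf⟩ := exists_contMDiffMap_one_nhds_of_subset_interior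
    (modelWithCornersSelf ℝ Spacetime) (n := ⊤) hK.isClosed hKK'
  refine ⟨⟨f, f.contMDiff.contDiff, HasCompactSupport.intro hK' hf0, ?_⟩, hf,
    fun x hx => hf1.self_of_nhdsSet x hx⟩
  exact (closure_minimal (fun x hx => by_contra fun h => Function.mem_support.1 hx (hf0 x h))
    hK'.isClosed).trans hK'M

/-! ### Operations on distributional forms -/

theorem ofForm_apply (F : SmoothForm M 2) (ψ : TestForm M 2) :
    Current.ofForm F ψ = ∫ x, topWedge (ψ x) (F.toFun x) :=
  TestFunction.integralAgainstBilinCLM_eq_integral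
    (F.smooth.continuousOn.locallyIntegrableOn M.isOpen.measurableSet)

theorem integrable_topWedge (F : SmoothForm M 2) (ψ : TestForm M 2) :
    MeasureTheory.Integrable fun x => topWedge (ψ x) (F.toFun x) :=
  TestFunction.integrable_bilin _
    (F.smooth.continuousOn.locallyIntegrableOn M.isOpen.measurableSet) ψ

theorem setIntegral_topWedge (F : SmoothForm M 2) (ψ : TestForm M 2) :
    ∫ x in M, topWedge (ψ x) (F.toFun x) = ∫ x, topWedge (ψ x) (F.toFun x) := by
  refine MeasureTheory.setIntegral_eq_integral_of_forall_compl_eq_zero fun x hx => ?_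
  rw [image_eq_zero_of_notMem_tsupport fun h => hx (ψ.tsupport_subset h), map_zero]
  rfl

/-- The pullback of smooth 2-forms agrees with their pullback as distributional forms. This is the
change of variables formula, and the only place where `φ` has to preserve the orientation. -/
theorem ofForm_pull (φ : OrientedDiffeo N M) (F : SmoothForm M 2) :
    Current.ofForm (F.pull φ) = (Current.ofForm F).pull φ := by
  ext ψ
  change _ = Current.ofForm F (pullTest φ.symm 2 ψ)
  rw [ofForm_apply, ofForm_apply, ← setIntegral_topWedge, ← setIntegral_topWedge]
  have himage : (M : Set Spacetime) = φ.toFun '' N :=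
    Subset.antisymm (fun y hy => ⟨_, φ.mapsTo_inv hy, φ.right_inv hy⟩)
      (image_subset_iff.2 φ.mapsTo)
  rw [himage, MeasureTheory.integral_image_eq_integral_abs_det_fderiv_smul MeasureTheory.volume
    N.isOpen.measurableSet (f' := fderiv ℝ φ.toFun) (fun x hx =>
      ((φ.smooth.contDiffAt (N.isOpen.mem_nhds hx)).differentiableAt
        (by simp)).hasFDerivAt.hasFDerivWithinAt) φ.left_inv.injOn]
  refine MeasureTheory.setIntegral_congr_fun N.isOpen.measurableSet fun x hx => ?_
  have h1 : φ.symm.toFun (φ.toFun x) = x := φ.left_inv hx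
  rw [abs_of_pos (φ.det_pos x hx), smul_eq_mul, ← topWedge_pullAlt,
    pullTest_apply φ.symm ψ (φ.mapsTo hx), h1]
  exact congrArg (fun α => topWedge α ((F.pull φ).toFun x))
    (pullAlt_pullAlt_of_comp_eq_id 2 (φ.inv_fderiv_comp hx) (ψ x)).symm

/-- The Hodge dual of a smooth 2-form. -/
noncomputable def SmoothForm.starTwo (c : ℝ) (F : SmoothForm M 2) : SmoothForm M 2 where
  toFun x := star₂ c (F.toFun x)
  smooth := (ContinuousLinearMap.contDiff (star₂ (W := ℝ) c)).comp_contDiffOn F.smooth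

/-- The linear combination `a F + b G` of smooth forms. -/
noncomputable def SmoothForm.lin {k : ℕ} (a b : ℝ) (F G : SmoothForm M k) : SmoothForm M k where
  toFun x := a • F.toFun x + b • G.toFun x
  smooth := (F.smooth.const_smul a).add (G.smooth.const_smul b)

theorem ofForm_starTwo (c : ℝ) (F : SmoothForm M 2) :
    Current.ofForm (F.starTwo c) = (Current.ofForm F).starTwo c := by
  ext ψ
  change _ = Current.ofForm F (TestFunction.postcompCLM (star₂ c) ψ)
  rw [ofForm_apply, ofForm_apply]
  have h (x : Spacetime) : topWedge (ψ x) ((F.starTwo c).toFun x) =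
      topWedge (TestFunction.postcompCLM (star₂ c) ψ x) (F.toFun x) := by
    have e₁ : (F.starTwo c).toFun x = star₂ c (F.toFun x) := rfl
    have e₂ : TestFunction.postcompCLM (star₂ c) ψ x = star₂ c (ψ x) := rfl
    rw [e₁, e₂, topWedge_star₂]
  simp only [h]

theorem ofForm_lin (a b : ℝ) (F G : SmoothForm M 2) :
    Current.ofForm (F.lin a b G) = a • Current.ofForm F + b • Current.ofForm G := by
  ext ψ
  change _ = a * Current.ofForm F ψ + b * Current.ofForm G ψ
  rw [ofForm_apply, ofForm_apply, ofForm_apply, ← MeasureTheory.integral_const_mul,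
    ← MeasureTheory.integral_const_mul, ← MeasureTheory.integral_add
      ((integrable_topWedge F ψ).const_mul a) ((integrable_topWedge G ψ).const_mul b)]
  simp [SmoothForm.lin]

theorem Current.starTwo_starTwo {c : ℝ} (hc : c ≠ 0) (T : Current M 2) :
    (T.starTwo c).starTwo c = -T := by
  ext ψ
  change T (TestFunction.postcompCLM (star₂ c) (TestFunction.postcompCLM (star₂ c) ψ)) = -T ψ
  rw [← map_neg]
  congr 1
  ext1 x
  exact star₂_star₂ hc (ψ x)

theorem Current.starOne_starThreeInv {c : ℝ} (hc : c ≠ 0) (T : Current M 1) :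
    (T.starThreeInv c).starOne c = T := by
  ext ψ
  change - -T (TestFunction.postcompCLM (star₃ c) (TestFunction.postcompCLM (star₁ c) ψ)) = T ψ
  rw [neg_neg]
  congr 1
  ext1 x
  exact star₃_star₁ hc (ψ x)

theorem Current.d_pull (φ : OrientedDiffeo N M) {q : ℕ} (T : Current M (q + 1)) :
    (T.pull φ).d = T.d.pull φ := by
  ext ψ
  change (-1 : ℝ) ^ (q + 1) • T (pullTest φ.symm (q + 1) (dTest N q ψ)) =
    (-1 : ℝ) ^ (q + 1) • T (dTest M q (pullTest φ.symm q ψ))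
  rw [dTest_pullTest]

/-! ### Integration of kernels against 2-forms -/

/-- The integral of a kernel against a 2-form is unique. -/
theorem IsKernelIntegral.unique {κ : Kernel M} {F : SmoothForm M 2} {P Q : Current M 2}
    (hP : IsKernelIntegral κ F P) (hQ : IsKernelIntegral κ F Q) : P = Q := by
  ext ψ
  refine eq_of_forall_dist_le fun ε hε => ?_
  obtain ⟨K, hK, hKM, h⟩ := hP ψ (ε / 2) (half_pos hε)
  obtain ⟨K', hK', hKM', h'⟩ := hQ ψ (ε / 2) (half_pos hε)
  obtain ⟨χ, hχ, hχ1⟩ := exists_cutoff (hK.union hK') (union_subset hKM hKM')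
  have h1 := abs_lt.1 (h χ hχ fun x hx => hχ1 x (.inl hx))
  have h2 := abs_lt.1 (h' χ hχ fun x hx => hχ1 x (.inr hx))
  rw [Real.dist_eq, abs_le]
  constructor <;> linarith [h1.1, h1.2, h2.1, h2.2]

theorem IsKernelIntegral.add {κ κ' : Kernel M} {F : SmoothForm M 2} {P P' : Current M 2}
    (h : IsKernelIntegral κ F P) (h' : IsKernelIntegral κ' F P') :
    IsKernelIntegral (κ + κ') F (P + P') := by
  intro ψ ε hε
  obtain ⟨K, hK, hKM, h⟩ := h ψ (ε / 2) (half_pos hε)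
  obtain ⟨K', hK', hKM', h'⟩ := h' ψ (ε / 2) (half_pos hε)
  refine ⟨K ∪ K', hK.union hK', union_subset hKM hKM', fun χ hχ hχ1 => ?_⟩
  have h1 := abs_lt.1 (h χ hχ fun x hx => hχ1 x (.inl hx))
  have h2 := abs_lt.1 (h' χ hχ fun x hx => hχ1 x (.inr hx))
  rw [add_apply, add_apply, abs_lt]
  constructor <;> linarith [h1.1, h1.2, h2.1, h2.2]

theorem IsKernelIntegral.smul {κ : Kernel M} {F : SmoothForm M 2} {P : Current M 2}
    (h : IsKernelIntegral κ F P) (a : ℝ) : IsKernelIntegral (a • κ) F (a • P) := by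
  intro ψ ε hε
  obtain ⟨K, hK, hKM, h⟩ := h ψ (ε / (|a| + 1)) (by positivity)
  refine ⟨K, hK, hKM, fun χ hχ hχ1 => ?_⟩
  have h1 := h χ hχ hχ1
  rw [lt_div_iff₀ (by positivity)] at h1
  change |a * κ _ - a * P ψ| < ε
  rw [← mul_sub, abs_mul]
  nlinarith [abs_nonneg (κ (tensorTest ψ (F.cutoff χ)) - P ψ)]

/-- The kernel `Δ` acts as the identity: `∫_Y Δ ∧ π_Y^* F = F`. -/
theorem isKernelIntegral_delta (F : SmoothForm M 2) :
    IsKernelIntegral (Kernel.delta M) F (Current.ofForm F) := by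
  intro ψ ε hε
  refine ⟨tsupport ψ, ψ.hasCompactSupport, ψ.tsupport_subset, fun χ _ hχ => ?_⟩
  have h : Kernel.delta M (tensorTest ψ (F.cutoff χ)) = Current.ofForm F ψ := by
    rw [ofForm_apply]
    refine (TestFunction.integralAgainstBilinCLM_eq_integral
      ((MeasureTheory.locallyIntegrable_const (1 : ℝ)).locallyIntegrableOn _)).trans ?_
    refine MeasureTheory.integral_congr_ae (.of_forall fun x => ?_)
    change weightedComp (diagonal M) (fun _ => diagTop) contDiffOn_const
      (tensorTest ψ (F.cutoff χ)) x * 1 = _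
    rw [mul_one]
    by_cases hx : x ∈ tsupport ψ
    · rw [weightedComp_apply _ _ _ _ (ψ.tsupport_subset hx)]
      change topWedge (ψ x) (F.cutoff χ x) = _
      rw [SmoothForm.cutoff_apply _ _ (ψ.tsupport_subset hx), hχ x hx, one_smul]
    · have h0 : ψ x = 0 := image_eq_zero_of_notMem_tsupport hx
      change _ = topWedge (ψ x) (F.toFun x)
      rw [h0, map_zero]
      by_cases hxM : x ∈ M
      · rw [weightedComp_apply _ _ _ _ hxM]
        change topWedge (ψ x) (F.cutoff χ x) = _
        rw [h0, map_zero]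
        rfl
      · exact image_eq_zero_of_notMem_tsupport fun h' => hxM (TestFunction.tsupport_subset _ h')
  rwa [h, sub_self, abs_zero]

/-- Kernel integrals are natural under diffeomorphisms: the integral of `Ẑ_X⁻¹ φ_XY^* κ` against
`φ^* F` is `⋆⁻¹ φ^* ⋆ P` (with `⋆⁻¹ = -⋆`) if `P` is the integral of `κ` against `F`. -/
theorem IsKernelIntegral.transform {κ : Kernel M} {F : SmoothForm M 2} {P : Current M 2}
    (h : IsKernelIntegral κ F P) (c : ℝ) (φ : OrientedDiffeo N M) :
    IsKernelIntegral (ZXInv c φ (κ.pullXY φ)) (F.pull φ)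
      (-(((P.starTwo c).pull φ).starTwo c)) := by
  intro ψ ε hε
  let S : TestForm M 2 := TestFunction.postcompCLM (star₂ c)
    (pullTest φ.symm 2 (TestFunction.postcompCLM (star₂ c) ψ))
  obtain ⟨K, hK, hKM, h⟩ := h S ε hε
  refine ⟨φ.invFun '' K, hK.image_of_continuousOn (φ.smooth_inv.continuousOn.mono hKM),
    image_subset_iff.2 fun y hy => φ.mapsTo_inv (hKM hy), fun χ hχ hχ1 => ?_⟩
  have h1 := h (pullScalar φ.symm χ) (pullScalar_mem_Icc φ.symm hχ) fun y hy => by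
    rw [pullScalar_apply _ _ (hKM hy)]
    exact hχ1 _ ⟨y, hy, rfl⟩
  have h2 : ZXInv c φ (κ.pullXY φ) (tensorTest ψ ((F.pull φ).cutoff χ)) =
      -κ (tensorTest S (F.cutoff (pullScalar φ.symm χ))) := by
    change -κ (pullTestKernel φ.symm (pullTestKernel φ (TestFunction.postcompCLM (star₂ c)
      (pullTestKernel φ.symm (TestFunction.postcompCLM (star₂ c)
        (tensorTest ψ ((F.pull φ).cutoff χ))))))) = _
    rw [pullTestKernel_symm_pullTestKernel, postcompCLM_star₂_tensorTest,
      pullTestKernel_tensorTest, postcompCLM_star₂_tensorTest, pullTest_symm_cutoff_pull]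
  have h3 : (-(((P.starTwo c).pull φ).starTwo c)) ψ = -P S := rfl
  rwa [h2, h3, ← neg_sub', abs_neg]

/-- The polarization `Π̂ = ⋆⁻¹ φ^* ⋆ (ε₀ F + Π) - ε₀ φ^* F`, with `⋆⁻¹ = -⋆`. -/
noncomputable def Current.hatPolarization (c ε₀ : ℝ) (φ : OrientedDiffeo N M) (F : SmoothForm M 2)
    (P : Current M 2) : Current N 2 :=
  -((((ε₀ • Current.ofForm F + P).starTwo c).pull φ).starTwo c) -
    ε₀ • Current.ofForm (F.pull φ)

theorem isKernelIntegral_kappaHat {κ : Kernel M} {F : SmoothForm M 2} {P : Current M 2}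
    (h : IsKernelIntegral κ F P) (c ε₀ : ℝ) (φ : OrientedDiffeo N M) :
    IsKernelIntegral (kappaHat c ε₀ φ κ) (F.pull φ) (P.hatPolarization c ε₀ φ F) := by
  have h1 := (((isKernelIntegral_delta F).smul ε₀).add h).transform c φ
  have h2 := h1.add ((isKernelIntegral_delta (F.pull φ)).smul (-ε₀))
  intro ψ ε hε
  obtain ⟨K, hK, hKM, h3⟩ := h2 ψ ε hε
  refine ⟨K, hK, hKM, fun χ hχ hχ1 => lt_of_eq_of_lt (congrArg abs ?_) (h3 χ hχ hχ1)⟩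
  simp only [kappaHat, Current.hatPolarization, sub_apply, add_apply, smul_apply, smul_eq_mul]
  ring

/-! ### Maxwell's equations -/

/-- The transformed polarization is chosen such that `⋆(ε₀ φ^* F + Π̂) = φ^* ⋆(ε₀ F + Π)`. -/
theorem starTwo_hatPolarization {c : ℝ} (hc : c ≠ 0) (ε₀ : ℝ) (φ : OrientedDiffeo N M)
    (F : SmoothForm M 2) (P : Current M 2) :
    (ε₀ • Current.ofForm (F.pull φ) + P.hatPolarization c ε₀ φ F).starTwo c =
      ((ε₀ • Current.ofForm F + P).starTwo c).pull φ := by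
  rw [Current.hatPolarization, add_sub_cancel]
  ext ψ
  exact (congrArg (fun T => -T ψ) (Current.starTwo_starTwo hc
    (((ε₀ • Current.ofForm F + P).starTwo c).pull φ))).trans (neg_neg _)

theorem MaxwellDist.transform {c ε₀ : ℝ} (hc : c ≠ 0) {F : SmoothForm M 2} {P : Current M 2}
    {J : Current M 3} (h : MaxwellDist c ε₀ F P J) (φ : OrientedDiffeo N M) :
    MaxwellDist c ε₀ (F.pull φ) (P.hatPolarization c ε₀ φ F) (J.transformed c φ) := by
  unfold MaxwellDist at h ⊢
  rw [starTwo_hatPolarization hc, Current.d_pull, h, Current.transformed,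
    Current.starOne_starThreeInv hc]
  rfl

/-- The smooth version of `Current.hatPolarization`. -/
noncomputable def SmoothForm.hatPolarization (c ε₀ : ℝ) (φ : OrientedDiffeo N M)
    (F P : SmoothForm M 2) : SmoothForm N 2 :=
  ((((F.lin ε₀ 1 P).starTwo c).pull φ).starTwo c).lin (-1) (-ε₀) (F.pull φ)

theorem ofForm_hatPolarization (c ε₀ : ℝ) (φ : OrientedDiffeo N M) (F P : SmoothForm M 2) :
    Current.ofForm (F.hatPolarization c ε₀ φ P) =
      (Current.ofForm P).hatPolarization c ε₀ φ F := by
  rw [SmoothForm.hatPolarization, ofForm_lin, ofForm_starTwo, ofForm_pull, ofForm_starTwo,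
    ofForm_lin, one_smul, Current.hatPolarization]
  ext ψ
  simp only [sub_apply, add_apply, smul_apply, neg_apply, smul_eq_mul]
  ring

theorem MaxwellSmooth.transform {c ε₀ : ℝ} (hc : c ≠ 0) {F P : SmoothForm M 2}
    {J : SmoothForm M 1} (h : MaxwellSmooth c ε₀ F P J) (φ : OrientedDiffeo N M) :
    MaxwellSmooth c ε₀ (F.pull φ) (F.hatPolarization c ε₀ φ P) (J.transformed c φ) := by
  intro x hx
  have h1 : (fun y => star₂ c (ε₀ • (F.pull φ).toFun y +
      (F.hatPolarization c ε₀ φ P).toFun y)) =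
      fun y => pullAlt 2 ℝ (fderiv ℝ φ.toFun y)
        (star₂ c (ε₀ • F.toFun (φ.toFun y) + P.toFun (φ.toFun y))) := by
    funext y
    have h2 : ε₀ • (F.pull φ).toFun y + (F.hatPolarization c ε₀ φ P).toFun y =
        -star₂ c (pullAlt 2 ℝ (fderiv ℝ φ.toFun y)
          (star₂ c (ε₀ • F.toFun (φ.toFun y) + (1 : ℝ) • P.toFun (φ.toFun y)))) := by
      change ε₀ • (F.pull φ).toFun y + ((-1 : ℝ) • star₂ c (pullAlt 2 ℝ (fderiv ℝ φ.toFun y)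
          (star₂ c (ε₀ • F.toFun (φ.toFun y) + (1 : ℝ) • P.toFun (φ.toFun y)))) +
          (-ε₀) • (F.pull φ).toFun y) = _
      module
    rw [h2, map_neg, star₂_star₂ hc, neg_neg, one_smul]
  rw [h1, extDeriv_pullAlt φ (η := fun y => star₂ c (ε₀ • F.toFun y + P.toFun y)) ?_ hx,
    h _ (φ.mapsTo hx), map_smul]
  · change _ = (c ^ 2)⁻¹ • star₁ c (star₃ c
      (pullAlt 3 ℝ (fderiv ℝ φ.toFun x) (star₁ c (J.toFun (φ.toFun x)))))
    rw [star₁_star₃ hc]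
  · exact (ContinuousLinearMap.contDiff (star₂ (W := ℝ) c)).comp_contDiffOn
      ((F.smooth.const_smul ε₀).add P.smooth)

theorem SmoothForm.Closed.pull {k : ℕ} {F : SmoothForm M k} (hF : F.Closed)
    (φ : OrientedDiffeo N M) : (F.pull φ).Closed := fun x hx => by
  rw [SmoothForm.pull, extDeriv_pullAlt φ F.smooth hx, hF _ (φ.mapsTo hx), map_zero]

end SpacetimeOptics

theorem mainTheorem2 (c ε₀ : ℝ) (hc : 0 < c) (M N : Opens Spacetime) (φ : OrientedDiffeo N M)
    (κ : Kernel M) (F : SmoothForm M 2) (hF : F.Closed) :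
    (F.pull φ).Closed ∧
    (∀ (P : Current M 2) (J : Current M 3),
      IsKernelIntegral κ F P → MaxwellDist c ε₀ F P J →
        ∃ P' : Current N 2,
          (∀ Q : Current N 2, IsKernelIntegral (kappaHat c ε₀ φ κ) (F.pull φ) Q ↔ Q = P') ∧
          MaxwellDist c ε₀ (F.pull φ) P' (J.transformed c φ)) ∧
    (∀ (P : SmoothForm M 2) (J : SmoothForm M 1),
      IsKernelIntegral κ F (Current.ofForm P) → MaxwellSmooth c ε₀ F P J →
        ∃ P' : SmoothForm N 2,
          (∀ Q : Current N 2,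
            IsKernelIntegral (kappaHat c ε₀ φ κ) (F.pull φ) Q ↔ Q = Current.ofForm P') ∧
          MaxwellSmooth c ε₀ (F.pull φ) P' (J.transformed c φ)) := by
  refine ⟨hF.pull φ, fun P J hP hJ => ⟨P.hatPolarization c ε₀ φ F, fun Q => ?_,
    hJ.transform hc.ne' φ⟩, fun P J hP hJ => ⟨F.hatPolarization c ε₀ φ P, fun Q => ?_,
    hJ.transform hc.ne' φ⟩⟩
  · have h := isKernelIntegral_kappaHat hP c ε₀ φ
    exact ⟨fun hQ => hQ.unique h, fun hQ => hQ ▸ h⟩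
  · have h := isKernelIntegral_kappaHat hP c ε₀ φ
    rw [ofForm_hatPolarization]
    exact ⟨fun hQ => hQ.unique h, fun hQ => hQ ▸ h⟩
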